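/- Let $0<\theta<1$, let $I$ be a set, let $\lambda_i>0$ ($i\in I$), and let $H$ be a complex Hilbert space with an orthonormal basis that is the disjoint union of two families $(e_i)_{i\in I}$ and $(e'_i)_{i\in I}$. Let $\mathcal F=\mathbb C\oplus H\oplus H^{\otimes 2}\oplus\cdots$ be the full Fock space over $H$, with vacuum vector $\Omega=1\in\mathbb C$; for $h\in H$ let $\ell(h)x=h\otimes x$ be the left creation operator on $\mathcal F$, and put $\ell_i=\ell(e_i)$, $\ell'_i=\ell(e'_i)$. Let $\xi_i=\theta(1-\theta)^{-1}\lambda_i^{-1/2}$ and $$x_i=(1-\theta)\lambda_i^{\theta/2}\,(\ell_i+\xi_i\,\ell_i'^{*}),$$ let $\mathcal L\subset B(\mathcal F)$ be the von Neumann algebra generated by $(x_i)_{i\in I}$, with predual $\mathcal L_*$ (the normal functionals, with the operator space structure inherited from $\mathcal L^*$), and let $X=\overline{\mathrm{span}}[x_i\mid i\in I]$ be the norm-closed linear span. Let $Q$ and $Q'$ be the orthogonal projections of $\mathcal F$ onto $\overline{\mathrm{span}}[e_i]$ and $\overline{\mathrm{span}}[e'_i]$, where $H$ is regarded as the space of tensors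 of degree $1$ in $\mathcal F$. (i) The formula $$P(T)=\ell(Q(T\Omega))+\ell(Q'(T^*\Omega))^*\qquad(T\in\mathcal L)$$ defines a linear map $P:\mathcal L\to\mathcal L$ that is normal (weak*-continuous), is a projection ($P\circ P=P$) with range $X$, and satisfies $\|P\|_{cb}\le 2$. (So $X$ is completely $2$-complemented in $\mathcal L$.) (ii) Let $C$ and $R$ be the column and the row Hilbert space over $\ell_2(I)$, with canonical bases $(e_{i1})$ and $(e_{1i})$, let $\Lambda:C\to R$ be the (possibly unbounded) operator with $\Lambda e_{i1}=\xi_i e_{1i}$, with domain $\{\sum_i t_ie_{i1}\in C\mid\sum_i|\xi_it_i|^2<\infty\}$, and let $G(\Lambda)=\{(t,\Lambda t)\mid t\in\mathrm{Dom}(\Lambda)\}\subset C\oplus_\infty R$. There is a complete isomorphism of $X$ onto $G(\Lambda)$ that takes $\ell_i+\xi_i\ell_i'^{*}$ to $(e_{i1},\xi_ie_{1i})$ for every $i\in I$. (iii) The dual operator space $X^*$ embeds completely isomorphically into $\mathcal L_*$. -/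

import Mathlib

open scoped TensorProduct InnerProductSpace

noncomputable section

universe u v

/-! ## The full Fock space and its creation operators -/

/-- A bundled complex Hilbert space. -/
structure HilbertBundle : Type (u + 1) where
  carrier : Type u
  [group : NormedAddCommGroup carrier]
  [inner : InnerProductSpace ℂ carrier]
  [complete : CompleteSpace carrier]

attribute [instance] HilbertBundle.group HilbertBundle.inner HilbertBundle.complete

/-- The Hilbert space tensor powers of `H`. The power of order `0` is the one-dimensional Hilbert
space `ℂ` (written as `EuclideanSpace ℂ PUnit` for universe reasons only), and the power of order
`n + 1` is the completion of the algebraic tensor product of `H` with the power of order `n`. -/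
def hilbertTensorPower (H : Type u) [NormedAddCommGroup H] [InnerProductSpace ℂ H] :
    ℕ → HilbertBundle.{u}
  | 0 => ⟨EuclideanSpace ℂ PUnit.{u + 1}⟩
  | n + 1 => ⟨UniformSpace.Completion (H ⊗[ℂ] (hilbertTensorPower H n).carrier)⟩

section Fock

variable {H : Type u} [NormedAddCommGroup H] [InnerProductSpace ℂ H]

/-- The elementary tensor `h ⊗ x` in the tensor power of order `n + 1`. -/
def leftTensor (h : H) {n : ℕ} (x : (hilbertTensorPower H n).carrier) :
    (hilbertTensorPower H (n + 1)).carrier :=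
  ((h ⊗ₜ[ℂ] x : H ⊗[ℂ] (hilbertTensorPower H n).carrier) :
    UniformSpace.Completion (H ⊗[ℂ] (hilbertTensorPower H n).carrier))

theorem leftTensor_add_left (h k : H) {n : ℕ} (x : (hilbertTensorPower H n).carrier) :
    leftTensor (h + k) x = leftTensor h x + leftTensor k x :=
  (congrArg _ (TensorProduct.add_tmul h k x)).trans (UniformSpace.Completion.coe_add _ _)

theorem leftTensor_add_right (h : H) {n : ℕ} (x y : (hilbertTensorPower H n).carrier) :
    leftTensor h (x + y) = leftTensor h x + leftTensor h y :=
  (congrArg _ (TensorProduct.tmul_add h x y)).trans (UniformSpace.Completion.coe_add _ _)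

theorem leftTensor_smul_left (c : ℂ) (h : H) {n : ℕ} (x : (hilbertTensorPower H n).carrier) :
    leftTensor (c • h) x = c • leftTensor h x :=
  (congrArg _ (TensorProduct.smul_tmul' c h x).symm).trans (UniformSpace.Completion.coe_smul _ _)

theorem leftTensor_smul_right (c : ℂ) (h : H) {n : ℕ} (x : (hilbertTensorPower H n).carrier) :
    leftTensor h (c • x) = c • leftTensor h x :=
  (congrArg _ (TensorProduct.tmul_smul c h x)).trans (UniformSpace.Completion.coe_smul _ _)

theorem norm_leftTensor (h : H) {n : ℕ} (x : (hilbertTensorPower H n).carrier) :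
    ‖leftTensor h x‖ = ‖h‖ * ‖x‖ :=
  (UniformSpace.Completion.norm_coe _).trans (TensorProduct.norm_tmul h x)

variable (H) in
/-- The full Fock space `ℂ ⊕ H ⊕ H^{⊗2} ⊕ ⋯` over `H` (Hilbert space direct sum). -/
abbrev FullFock : Type u := lp (fun n : ℕ => (hilbertTensorPower H n).carrier) 2

variable (H) in
/-- The unit `1` of the tensor power `ℂ` of order zero. -/
def tensorUnit : (hilbertTensorPower H 0).carrier :=
  (EuclideanSpace.single PUnit.unit (1 : ℂ) : EuclideanSpace ℂ PUnit.{u + 1})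

variable (H) in
/-- The vacuum vector, i.e. the unit of the summand `ℂ` of the full Fock space. -/
def vacuum : FullFock H := lp.single 2 0 (tensorUnit H)

/-- The components of `h ⊗ x` for `x` in the full Fock space. -/
def creationFun (h : H) (x : FullFock H) : (n : ℕ) → (hilbertTensorPower H n).carrier
  | 0 => 0
  | n + 1 => leftTensor h (x n)

theorem hasSum_norm_creationFun (h : H) (x : FullFock H) :
    HasSum (fun n => ‖creationFun h x n‖ ^ (2 : ENNReal).toReal) ((‖h‖ * ‖x‖) ^ (2 : ENNReal).toReal)
    := by
  have h2 : 0 < (2 : ENNReal).toReal := by norm_num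
  rw [← hasSum_nat_add_iff' 1]
  have h0 : ‖creationFun h x 0‖ ^ (2 : ENNReal).toReal = 0 := by
    simp [creationFun]
  simp only [Finset.range_one, Finset.sum_singleton, h0, sub_zero]
  have := (lp.hasSum_norm h2 x).mul_left (‖h‖ ^ (2 : ENNReal).toReal)
  rw [← Real.mul_rpow (norm_nonneg _) (norm_nonneg _)] at this
  refine this.congr_fun ?_
  intro n
  simp only [creationFun, norm_leftTensor]
  rw [Real.mul_rpow (norm_nonneg _) (norm_nonneg _)]

/-- The left creation operators `ℓ(h) : x ↦ h ⊗ x` on the full Fock space, as a map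
that is linear and bounded in both `h` and `x`. -/
def creation : H →L[ℂ] FullFock H →L[ℂ] FullFock H :=
  LinearMap.mkContinuous₂
    (LinearMap.mk₂ ℂ
      (fun h x => (⟨creationFun h x, memℓp_gen (hasSum_norm_creationFun h x).summable⟩ : FullFock H))
      (fun h k x => lp.ext (funext fun n => by
        cases n with
        | zero => exact (add_zero _).symm
        | succ n => exact leftTensor_add_left h k (x n)))
      (fun c h x => lp.ext (funext fun n => by
        cases n with
        | zero => exact (smul_zero c).symm
        | succ n => exact leftTensor_smul_left c h (x n)))
      (fun h x y => lp.ext (funext fun n => by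
        cases n with
        | zero => exact (add_zero _).symm
        | succ n => exact leftTensor_add_right h (x n) (y n)))
      (fun c h x => lp.ext (funext fun n => by
        cases n with
        | zero => exact (smul_zero c).symm
        | succ n => exact leftTensor_smul_right c h (x n))))
    1
    (fun h x => by
      have h2 : 0 < (2 : ENNReal).toReal := by norm_num
      rw [one_mul]
      exact lp.norm_le_of_tsum_le h2 (by positivity) (hasSum_norm_creationFun h x).tsum_eq.le)

/-- The embedding of `H` into the full Fock space as the tensors of degree one, `h ↦ h ⊗ Ω`. -/
def degreeOne : H →L[ℂ] FullFock H := creation.flip (vacuum H)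

end Fock

/-! ## Operator spaces -/

/-- The norms on the square matrices with entries in `E`. -/
abbrev MatrixNorms (E : Type*) := ∀ n : ℕ, Matrix (Fin n) (Fin n) E → ℝ

/-- The operator from `H ⊕ ⋯ ⊕ H` to `K ⊕ ⋯ ⊕ K` with matrix entries `a i j`. -/
def matrixOperator {H K : Type*} [NormedAddCommGroup H] [InnerProductSpace ℂ H]
    [NormedAddCommGroup K] [InnerProductSpace ℂ K] {n : ℕ}
    (a : Matrix (Fin n) (Fin n) (H →L[ℂ] K)) :
    PiLp 2 (fun _ : Fin n => H) →L[ℂ] PiLp 2 (fun _ : Fin n => K) :=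
  (PiLp.continuousLinearEquiv 2 ℂ (fun _ : Fin n => K)).symm.toContinuousLinearMap ∘L
    ContinuousLinearMap.pi fun i =>
      ∑ j, a i j ∘L (PiLp.proj 2 (fun _ : Fin n => H) j : PiLp 2 (fun _ : Fin n => H) →L[ℂ] H)

/-- The dual space of a complex normed space. -/
abbrev NormedDual (E : Type*) [NormedAddCommGroup E] [NormedSpace ℂ E] := StrongDual ℂ E

namespace MatrixNorms

/-- The natural operator space structure of `B(H, K)`. -/
def operators (H K : Type*) [NormedAddCommGroup H] [InnerProductSpace ℂ H]
    [NormedAddCommGroup K] [InnerProductSpace ℂ K] : MatrixNorms (H →L[ℂ] K) :=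
  fun _ a => ‖matrixOperator a‖

/-- The operator space structure of a subspace. -/
def sub {E : Type*} [AddCommGroup E] [Module ℂ E] (ν : MatrixNorms E) (V : Submodule ℂ E) :
    MatrixNorms V :=
  fun n a => ν n (a.map V.subtype)

/-- The direct sum of two operator spaces in the sense of `ℓ_∞`. -/
def directSum {E F : Type*} (ν : MatrixNorms E) (μ : MatrixNorms F) : MatrixNorms (E × F) :=
  fun n a => max (ν n (a.map Prod.fst)) (μ n (a.map Prod.snd))

/-- The operator space structure of the dual space `E*`: the norm of a matrix `f` over `E*` is the
completely bounded norm of `x ↦ (f i j x)` from `E` to the scalar matrices, that is the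
least `C` such that the scalar matrix with entries `f i j (x k l)` has operator norm at most
`C ‖x‖` for all square matrices `x` over `E`. -/
def dual {E : Type*} [NormedAddCommGroup E] [NormedSpace ℂ E] (ν : MatrixNorms E) :
    MatrixNorms (NormedDual E) :=
  fun n f => sInf {C : ℝ | 0 ≤ C ∧ ∀ (m : ℕ) (x : Matrix (Fin m) (Fin m) E),
    ‖Matrix.toEuclideanCLM (𝕜 := ℂ) (n := Fin n × Fin m)
      (Matrix.of fun p q => f p.1 q.1 (x p.2 q.2))‖ ≤ C * ν m x}

/-- The column Hilbert space `H_c = B(ℂ, H)`. -/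
def column (H : Type*) [NormedAddCommGroup H] [InnerProductSpace ℂ H] : MatrixNorms H :=
  fun n a => operators ℂ H n (a.map fun x => ContinuousLinearMap.toSpanSingleton ℂ x)

/-- The row Hilbert space over `ℓ²(I)`: a vector `x` acts as the operator `y ↦ ∑ i, x i * y i`
from `ℓ²(I)` to `ℂ`. -/
def row (I : Type*) : MatrixNorms (lp (fun _ : I => ℂ) 2) :=
  fun n a => operators (lp (fun _ : I => ℂ) 2) ℂ n (a.map fun x => innerSL ℂ (star x))

end MatrixNorms

/-- `‖u‖_cb ≤ C`. -/
def CBNormLE {E F : Type*} [AddCommGroup E] [Module ℂ E] [AddCommGroup F] [Module ℂ F]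
    (ν : MatrixNorms E) (μ : MatrixNorms F) (u : E →ₗ[ℂ] F) (C : ℝ) : Prop :=
  0 ≤ C ∧ ∀ (n : ℕ) (a : Matrix (Fin n) (Fin n) E), μ n (a.map u) ≤ C * ν n a

/-- The linear map `u` is a completely isomorphic embedding: it is completely bounded, and so is its
inverse, which is defined on the range of `u`. -/
def IsCompletelyIsomorphicEmbedding {E F : Type*} [AddCommGroup E] [Module ℂ E] [AddCommGroup F]
    [Module ℂ F] (ν : MatrixNorms E) (μ : MatrixNorms F) (u : E →ₗ[ℂ] F) : Prop :=
  Function.Injective u ∧ (∃ C : ℝ, CBNormLE ν μ u C) ∧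
    ∃ C : ℝ, 0 ≤ C ∧ ∀ (n : ℕ) (a : Matrix (Fin n) (Fin n) E), ν n a ≤ C * μ n (a.map u)

/-- The linear equivalence `u` is a complete isomorphism. -/
def IsCompleteIsomorphism {E F : Type*} [AddCommGroup E] [Module ℂ E] [AddCommGroup F]
    [Module ℂ F] (ν : MatrixNorms E) (μ : MatrixNorms F) (u : E ≃ₗ[ℂ] F) : Prop :=
  (∃ C : ℝ, CBNormLE ν μ u.toLinearMap C) ∧ ∃ C : ℝ, CBNormLE μ ν u.symm.toLinearMap C

/-- The norm-closed linear span of a subset of a normed space. -/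
def closedSpan {E : Type*} [NormedAddCommGroup E] [NormedSpace ℂ E] (s : Set E) : Submodule ℂ E :=
  (Submodule.span ℂ s).topologicalClosure

/-! ## Von Neumann algebras -/

section VonNeumann

variable {K : Type v} [NormedAddCommGroup K] [InnerProductSpace ℂ K] [CompleteSpace K]

/-- The von Neumann algebra generated by a set `S` of operators: the double commutant of
`S ∪ S*`. -/
def generatedVonNeumannAlgebra (S : Set (K →L[ℂ] K)) : VonNeumannAlgebra K where
  toStarSubalgebra :=
    StarSubalgebra.centralizer ℂ (StarSubalgebra.centralizer ℂ S : Set (K →L[ℂ] K))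
  centralizer_centralizer' := by
    change Set.centralizer (Set.centralizer
      (StarSubalgebra.centralizer ℂ (StarSubalgebra.centralizer ℂ S : Set (K →L[ℂ] K)) :
        Set (K →L[ℂ] K))) =
      (StarSubalgebra.centralizer ℂ (StarSubalgebra.centralizer ℂ S : Set (K →L[ℂ] K)) :
        Set (K →L[ℂ] K))
    rw [StarSubalgebra.coe_centralizer_centralizer, Set.centralizer_centralizer_centralizer]

/-- The space of a von Neumann algebra, as a linear subspace of `B(K)`. -/
def VonNeumannAlgebra.space (M : VonNeumannAlgebra K) : Submodule ℂ (K →L[ℂ] K) :=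
  Subalgebra.toSubmodule M.toStarSubalgebra.toSubalgebra

/-- The natural operator space structure of a von Neumann algebra. -/
def VonNeumannAlgebra.matrixNorms (M : VonNeumannAlgebra K) : MatrixNorms M.space :=
  (MatrixNorms.operators K K).sub M.space

/-- The vector functional `T ↦ ⟨T ζ, η⟩` on a von Neumann algebra. -/
def VonNeumannAlgebra.vectorFunctional (M : VonNeumannAlgebra K) (ζ η : K) :
    NormedDual M.space :=
  innerSL ℂ η ∘L ContinuousLinearMap.apply ℂ K ζ ∘L M.space.subtypeL

/-- The predual `M_*` of a von Neumann algebra `M`: the space of its normal functionals, which is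
the norm-closed linear span of the vector functionals in the dual of `M`. -/
def VonNeumannAlgebra.predual (M : VonNeumannAlgebra K) : Submodule ℂ (NormedDual M.space) :=
  closedSpan (Set.range fun p : K × K => M.vectorFunctional p.1 p.2)

instance (M : VonNeumannAlgebra K) : AddCommGroup M.predual :=
  Submodule.addCommGroup M.predual

instance (M : VonNeumannAlgebra K) : Module ℂ M.predual :=
  Submodule.module M.predual

/-- The operator space structure of the predual, as a subspace of the dual operator space. -/
def VonNeumannAlgebra.predualMatrixNorms (M : VonNeumannAlgebra K) : MatrixNorms M.predual :=
  M.matrixNorms.dual.sub M.predual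

/-- The weak* (or σ-weak) topology `σ(M, M_*)`. -/
abbrev VonNeumannAlgebra.weakStarTopology (M : VonNeumannAlgebra K) : TopologicalSpace M.space :=
  TopologicalSpace.induced (fun T (f : M.predual) => (f : NormedDual M.space) T)
    Pi.topologicalSpace

/-- A linear map on a von Neumann algebra is normal if it is weak*-continuous. -/
def VonNeumannAlgebra.IsNormalMap (M : VonNeumannAlgebra K) (u : M.space →ₗ[ℂ] M.space) : Prop :=
  @Continuous M.space M.space M.weakStarTopology M.weakStarTopology u

end VonNeumann

/-! ## Generalized circular elements -/

section Circular

variable {I : Type v} {H : Type u} [NormedAddCommGroup H] [InnerProductSpace ℂ H]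

/-- `ξ_i = θ (1 - θ)⁻¹ λ_i^{-1/2}`. -/
def circularXi (θ : ℝ) (lam : I → ℝ) (i : I) : ℝ := θ * (1 - θ)⁻¹ * lam i ^ (-(1 / 2) : ℝ)

variable [CompleteSpace H]

/-- `ℓ_i + ξ_i ℓ'_i*`, where `ℓ_i = ℓ(e_i)` and `ℓ'_i = ℓ(e'_i)`, and the orthonormal basis `b`
of `H` consists of the `e_i = b (Sum.inl i)` and the `e'_i = b (Sum.inr i)`. -/
def circularCore (b : HilbertBasis (I ⊕ I) ℂ H) (ξ : I → ℝ) (i : I) :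
    FullFock H →L[ℂ] FullFock H :=
  creation (b (Sum.inl i)) +
    (ξ i : ℂ) • ContinuousLinearMap.adjoint (creation (b (Sum.inr i)))

/-- `x_i = (1 - θ) λ_i^{θ/2} (ℓ_i + ξ_i ℓ'_i*)`. -/
def circularElement (b : HilbertBasis (I ⊕ I) ℂ H) (θ : ℝ) (lam : I → ℝ) (i : I) :
    FullFock H →L[ℂ] FullFock H :=
  (((1 - θ) * lam i ^ (θ / 2) : ℝ) : ℂ) • circularCore b (circularXi θ lam) i

/-- The von Neumann algebra generated by the `x_i`. -/
def circularAlgebra (b : HilbertBasis (I ⊕ I) ℂ H) (θ : ℝ) (lam : I → ℝ) :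
    VonNeumannAlgebra (FullFock H) :=
  generatedVonNeumannAlgebra (Set.range (circularElement b θ lam))

/-- The norm-closed linear span of the `x_i`. -/
def circularSpan (b : HilbertBasis (I ⊕ I) ℂ H) (θ : ℝ) (lam : I → ℝ) :
    Submodule ℂ (FullFock H →L[ℂ] FullFock H) :=
  closedSpan (Set.range (circularElement b θ lam))

/-- The orthogonal projection of the full Fock space onto the closed linear span of a family of
vectors of `H`, which are regarded as tensors of degree one. -/
def degreeOneProjection (e : I → H) : FullFock H →L[ℂ] FullFock H :=
  (Submodule.span ℂ (Set.range fun i => degreeOne (e i))).topologicalClosure.starProjection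

/-- The operator `ℓ(v)` for a tensor `v` of degree one. The adjoint of the isometry `degreeOne`
is its inverse on the tensors of degree one. -/
def creationOfDegreeOne (v : FullFock H) : FullFock H →L[ℂ] FullFock H :=
  creation (ContinuousLinearMap.adjoint degreeOne v)

/-- `ℓ(Q(T Ω)) + ℓ(Q'(T* Ω))*`, where `Q` and `Q'` are the orthogonal projections onto the closed
spans of the `e_i` and of the `e'_i`. -/
def circularProjection (b : HilbertBasis (I ⊕ I) ℂ H) (T : FullFock H →L[ℂ] FullFock H) :
    FullFock H →L[ℂ] FullFock H :=
  creationOfDegreeOne (degreeOneProjection (fun i => b (Sum.inl i)) (T (vacuum H))) +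
    ContinuousLinearMap.adjoint
      (creationOfDegreeOne (degreeOneProjection (fun i => b (Sum.inr i))
        (ContinuousLinearMap.adjoint T (vacuum H))))

end Circular

/-- The unbounded diagonal operator `Λ` on `ℓ²(I)` with `Λ e_i = ξ_i e_i`, on its maximal
domain. -/
def diagonalOperator {I : Type v} (ξ : I → ℝ) :
    lp (fun _ : I => ℂ) 2 →ₗ.[ℂ] lp (fun _ : I => ℂ) 2 where
  domain :=
    { carrier := {x | Memℓp (fun i => (ξ i : ℂ) * x i) 2}
      zero_mem' := by simpa using! zero_memℓp
      add_mem' := fun {x y} hx hy => by simpa [mul_add] using! Memℓp.add hx hy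
      smul_mem' := fun c x hx => by simpa [mul_left_comm] using! Memℓp.const_smul hx c }
  toFun :=
    { toFun := fun x => ⟨fun i => (ξ i : ℂ) * (x : lp (fun _ : I => ℂ) 2) i, x.2⟩
      map_add' := fun x y => lp.ext (funext fun i => mul_add _ _ _)
      map_smul' := fun c x => lp.ext (funext fun i => mul_left_comm _ _ _) }

/-- The operator space structure of the graph `G(Λ) = {(x, Λ x) | x ∈ Dom Λ}`, as a subspace of
`C ⊕ R`, the direct sum of the column and the row Hilbert space over `ℓ²(I)`. -/
def graphMatrixNorms {I : Type v} (ξ : I → ℝ) : MatrixNorms (diagonalOperator ξ).graph :=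
  ((MatrixNorms.column (lp (fun _ : I => ℂ) 2)).directSum (MatrixNorms.row I)).sub
    (diagonalOperator ξ).graph

end

/-! The projection factors through `ℓ²(I) × ℓ²(I)`, viewed as `C ⊕ R`. Analysis
(`circularCoefficients`) sends `T` to `(t, s)`, where `t` holds the coefficients of `TΩ` along the
`e_i` and `s` the conjugated coefficients of `T*Ω` along the `e'_i`. Synthesis (`circularSynthesis`)
sends `(t, s)` back to `ℓ(∑ t_i e_i) + ℓ(∑ s̄_i e'_i)*`. Then `P` is synthesis after analysis, and
analysis after synthesis is the identity because `ℓ(h)Ω = h` and `ℓ(h)*Ω = 0`.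

Norms: both coordinates of the analysis map are compressions of `T`, so that map is completely
contractive. Since `ℓ(h)*ℓ(k) = ⟨h, k⟩`, a matrix of creation operators is bounded by its column
norm, and taking adjoints bounds annihilation operators by the row norm. The two summands give the
constant 2.

Range: the operator `r(e'_i) + ξ_i r(e_i)*`, built from right creation operators, commutes with
every `x_j` and `x_j*`, hence with `𝓛`. Applying this to `Ω` and pairing with `Ω` gives `s_i = ξ_i
t_i`: coefficients of elements of `𝓛` lie in the graph of `Λ` (`circularCoefficients_mem_graph`).
Synthesis is continuous and sends the basic graph vectors to multiples of the `x_i`, so it maps the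
graph into `X`. This yields (i), apart from normality, and (ii).

Duality: by the Riesz representation, `f ∘ P` is a sum of two vector functionals for every bounded
`f` on `X`. Hence `P` is normal, and `f ↦ f ∘ P` maps `X*` into the predual; restriction to `X`
inverts it, so it is a completely isomorphic embedding. -/

noncomputable section

universe u v

/-! ## Inner products on the full Fock space -/

section FockInner

variable {H : Type u} [NormedAddCommGroup H] [InnerProductSpace ℂ H]

theorem inner_leftTensor (h k : H) {n : ℕ} (x y : (hilbertTensorPower H n).carrier) :
    ⟪leftTensor h x, leftTensor k y⟫_ℂ = ⟪h, k⟫_ℂ * ⟪x, y⟫_ℂ :=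
  (UniformSpace.Completion.inner_coe _ _).trans (TensorProduct.inner_tmul ℂ h k x y)

theorem creation_apply_zero (h : H) (x : FullFock H) : (creation h x : FullFock H) 0 = 0 := rfl

theorem creation_apply_succ (h : H) (x : FullFock H) (n : ℕ) :
    (creation h x : FullFock H) (n + 1) = leftTensor h (x n) := rfl

theorem inner_creation (h k : H) (x y : FullFock H) :
    ⟪creation h x, creation k y⟫_ℂ = ⟪h, k⟫_ℂ * ⟪x, y⟫_ℂ := by
  have h1 : HasSum (fun n => ⟪(creation h x : FullFock H) (n + 1),
      (creation k y : FullFock H) (n + 1)⟫_ℂ) (⟪h, k⟫_ℂ * ⟪x, y⟫_ℂ) := by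
    have h2 : ∀ n, ⟪(creation h x : FullFock H) (n + 1), (creation k y : FullFock H) (n + 1)⟫_ℂ =
        ⟪h, k⟫_ℂ * ⟪x n, y n⟫_ℂ := fun n => inner_leftTensor h k (x n) (y n)
    rw [funext h2]
    exact HasSum.mul_left ⟪h, k⟫_ℂ (lp.hasSum_inner x y)
  have h3 := (hasSum_nat_add_iff (f := fun n => ⟪(creation h x : FullFock H) n,
      (creation k y : FullFock H) n⟫_ℂ) 1).1 h1
  rw [Finset.range_one, Finset.sum_singleton, creation_apply_zero, inner_zero_left, add_zero] at h3
  exact (lp.hasSum_inner (creation h x) (creation k y)).unique h3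

theorem norm_creation_apply (h : H) (x : FullFock H) : ‖creation h x‖ = ‖h‖ * ‖x‖ := by
  have h2 : ‖creation h x‖ ^ (2 : ENNReal).toReal = (‖h‖ * ‖x‖) ^ (2 : ENNReal).toReal :=
    (lp.hasSum_norm (by norm_num) (creation h x)).unique (hasSum_norm_creationFun h x)
  exact (Real.rpow_left_inj (norm_nonneg _) (by positivity) (by norm_num)).1 h2

theorem inner_vacuum (x : FullFock H) : ⟪vacuum H, x⟫_ℂ = ⟪tensorUnit H, x 0⟫_ℂ :=
  lp.inner_single_left _ _ _

theorem norm_tensorUnit : ‖tensorUnit H‖ = 1 :=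
  (PiLp.norm_single 2 (fun _ : PUnit => ℂ) PUnit.unit (1 : ℂ)).trans norm_one

theorem norm_vacuum : ‖vacuum H‖ = 1 := by
  rw [vacuum, lp.norm_single (by norm_num), norm_tensorUnit]

theorem inner_vacuum_creation (h : H) (x : FullFock H) : ⟪vacuum H, creation h x⟫_ℂ = 0 := by
  rw [inner_vacuum, creation_apply_zero, inner_zero_right]

theorem degreeOne_apply (h : H) : degreeOne h = creation h (vacuum H) := rfl

theorem inner_degreeOne (h k : H) : ⟪degreeOne h, degreeOne k⟫_ℂ = ⟪h, k⟫_ℂ := by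
  rw [degreeOne_apply, degreeOne_apply, inner_creation, inner_self_eq_norm_sq_to_K, norm_vacuum]
  simp

theorem norm_degreeOne_apply (h : H) : ‖degreeOne h‖ = ‖h‖ := by
  rw [degreeOne_apply, norm_creation_apply, norm_vacuum, mul_one]

theorem EuclideanSpace.eq_smul_single_unit (x : EuclideanSpace ℂ PUnit.{u + 1}) :
    x = x PUnit.unit • EuclideanSpace.single PUnit.unit (1 : ℂ) := by
  ext ⟨⟩
  simp

theorem tensorPower_zero_eq (x : (hilbertTensorPower H 0).carrier) :
    ∃ c : ℂ, x = c • tensorUnit H :=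
  ⟨_, EuclideanSpace.eq_smul_single_unit x⟩

/-- The elementary tensors are total in the tensor powers of `H`. -/
theorem eq_zero_of_inner_leftTensor {n : ℕ} (x : (hilbertTensorPower H (n + 1)).carrier)
    (hx : ∀ (h : H) (y : (hilbertTensorPower H n).carrier), ⟪leftTensor h y, x⟫_ℂ = 0) : x = 0 := by
  have key : ∀ z : (hilbertTensorPower H (n + 1)).carrier, ⟪z, x⟫_ℂ = 0 := by
    intro z
    refine UniformSpace.Completion.induction_on
      (p := fun z : (hilbertTensorPower H (n + 1)).carrier => ⟪z, x⟫_ℂ = 0) z ?_ ?_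
    · exact isClosed_eq (continuous_id.inner continuous_const) continuous_const
    · intro a
      induction a using TensorProduct.induction_on with
      | zero => exact inner_zero_left x
      | tmul h y => exact hx h y
      | add a b ha hb =>
        rw [UniformSpace.Completion.coe_add]
        exact (inner_add_left _ _ _).trans (by rw [ha, hb, add_zero])
  exact inner_self_eq_zero.1 (key x)

/-- The vacuum vector and the ranges of the creation operators are total. -/
theorem eq_zero_of_inner_vacuum_of_inner_creation (x : FullFock H) (h0 : ⟪vacuum H, x⟫_ℂ = 0)
    (h1 : ∀ (h : H) (y : FullFock H), ⟪creation h y, x⟫_ℂ = 0) : x = 0 := by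
  refine lp.ext (funext fun n => ?_)
  cases n with
  | zero =>
    obtain ⟨c, hc⟩ := tensorPower_zero_eq (x 0)
    rw [inner_vacuum, hc, inner_smul_right, inner_self_eq_norm_sq_to_K, norm_tensorUnit] at h0
    have : c = 0 := by simpa using h0
    rw [hc, this, zero_smul]
    rfl
  | succ n =>
    refine eq_zero_of_inner_leftTensor _ fun h y => ?_
    -- Testing against a `y` concentrated in degree `n` isolates the component of `x` in degree `n +
    -- 1`.
    rw [← h1 h (lp.single 2 n y)]
    refine HasSum.unique ?_ (lp.hasSum_inner _ _)
    have := hasSum_ite_eq (n + 1) (⟪leftTensor h y, x (n + 1)⟫_ℂ)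
    refine this.congr_fun ?_
    intro m
    cases m with
    | zero => simp [creation_apply_zero]
    | succ m =>
      rw [creation_apply_succ]
      by_cases hm : m = n
      · subst hm
        rw [if_pos rfl, lp.single_apply_self]
      · rw [if_neg (by omega), lp.single_apply_ne _ _ _ hm]
        have : leftTensor h (0 : (hilbertTensorPower H m).carrier) = 0 := by
          have := leftTensor_smul_right (0 : ℂ) h (0 : (hilbertTensorPower H m).carrier)
          rwa [zero_smul, zero_smul] at this
        rw [this, inner_zero_left]

/-- Bounded operators on the full Fock space that agree on the vacuum vector and on the ranges of
the creation operators are equal. -/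
theorem fullFock_ext {F : Type*} [NormedAddCommGroup F] [InnerProductSpace ℂ F]
    [CompleteSpace F] {S T : FullFock H →L[ℂ] F} (h0 : S (vacuum H) = T (vacuum H))
    (h1 : ∀ (h : H) (y : FullFock H), S (creation h y) = T (creation h y)) : S = T := by
  rw [← sub_eq_zero]
  -- The range of `(S - T)*` is orthogonal to a total set.
  have key : ContinuousLinearMap.adjoint (S - T) = 0 := by
    ext1 z
    refine eq_zero_of_inner_vacuum_of_inner_creation _ ?_ fun h y => ?_
    · rw [ContinuousLinearMap.adjoint_inner_right, sub_apply, h0, sub_self,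
        inner_zero_left]
    · rw [ContinuousLinearMap.adjoint_inner_right, sub_apply, h1, sub_self,
        inner_zero_left]
  simpa using congrArg ContinuousLinearMap.adjoint key

theorem adjoint_creation_vacuum (h : H) :
    ContinuousLinearMap.adjoint (creation h) (vacuum H) = 0 := by
  refine ext_inner_right ℂ fun y => ?_
  rw [ContinuousLinearMap.adjoint_inner_left, inner_vacuum_creation, inner_zero_left]

theorem adjoint_creation_creation (h k : H) (x : FullFock H) :
    ContinuousLinearMap.adjoint (creation h) (creation k x) = ⟪h, k⟫_ℂ • x := by
  refine ext_inner_left ℂ fun y => ?_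
  rw [ContinuousLinearMap.adjoint_inner_right, inner_creation, inner_smul_right]

theorem adjoint_degreeOne_degreeOne [CompleteSpace H] (h : H) :
    ContinuousLinearMap.adjoint degreeOne (degreeOne h) = h := by
  refine ext_inner_left ℂ fun y => ?_
  rw [ContinuousLinearMap.adjoint_inner_right, inner_degreeOne]

end FockInner

/-! ## Right creation operators -/

section RightCreation

/-- The isometry `1 ⊗ u` between completed tensor products. -/
def completionLTensor (H : Type*) {E F : Type*} [NormedAddCommGroup H] [InnerProductSpace ℂ H]
    [NormedAddCommGroup E] [InnerProductSpace ℂ E] [NormedAddCommGroup F] [InnerProductSpace ℂ F]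
    (u : E →ₗᵢ[ℂ] F) :
    UniformSpace.Completion (H ⊗[ℂ] E) →ₗᵢ[ℂ] UniformSpace.Completion (H ⊗[ℂ] F) where
  toLinearMap := ((UniformSpace.Completion.toComplₗᵢ.toContinuousLinearMap ∘L
      (u.lTensor H).toContinuousLinearMap).extend
        (UniformSpace.Completion.toComplₗᵢ (𝕜 := ℂ) (E := H ⊗[ℂ] E)).toContinuousLinearMap).toLinearMap
  norm_map' x := by
    induction x using UniformSpace.Completion.induction_on with
    | hp => exact isClosed_eq (ContinuousLinearMap.continuous _).norm continuous_norm
    | ih a =>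
      have := ContinuousLinearMap.extend_eq
        (e := (UniformSpace.Completion.toComplₗᵢ (𝕜 := ℂ) (E := H ⊗[ℂ] E)).toContinuousLinearMap)
        (UniformSpace.Completion.toComplₗᵢ.toContinuousLinearMap ∘L
          (u.lTensor H).toContinuousLinearMap)
        UniformSpace.Completion.denseRange_coe
        (UniformSpace.Completion.isUniformInducing_coe _) a
      refine (congrArg norm this).trans ?_
      exact (UniformSpace.Completion.norm_coe _).trans
        (((u.lTensor H).norm_map a).trans (UniformSpace.Completion.norm_coe _).symm)

theorem completionLTensor_tmul {H E F : Type*} [NormedAddCommGroup H] [InnerProductSpace ℂ H]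
    [NormedAddCommGroup E] [InnerProductSpace ℂ E] [NormedAddCommGroup F] [InnerProductSpace ℂ F]
    (u : E →ₗᵢ[ℂ] F) (h : H) (x : E) :
    completionLTensor H u ((h ⊗ₜ[ℂ] x : H ⊗[ℂ] E) : UniformSpace.Completion (H ⊗[ℂ] E)) =
      ((h ⊗ₜ[ℂ] u x : H ⊗[ℂ] F) : UniformSpace.Completion (H ⊗[ℂ] F)) := by
  have := ContinuousLinearMap.extend_eq
    (e := (UniformSpace.Completion.toComplₗᵢ (𝕜 := ℂ) (E := H ⊗[ℂ] E)).toContinuousLinearMap)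
    (UniformSpace.Completion.toComplₗᵢ.toContinuousLinearMap ∘L
      (u.lTensor H).toContinuousLinearMap)
    UniformSpace.Completion.denseRange_coe
    (UniformSpace.Completion.isUniformInducing_coe _) (h ⊗ₜ[ℂ] x)
  refine this.trans ?_
  simp

variable {H : Type u} [NormedAddCommGroup H] [InnerProductSpace ℂ H]

/-- The isometry `x ↦ x ⊗ k` between the tensor powers of `H`, for a unit vector `k`. -/
def rightTensor (k : H) (hk : ‖k‖ = 1) :
    (n : ℕ) → (hilbertTensorPower H n).carrier →ₗᵢ[ℂ] (hilbertTensorPower H (n + 1)).carrier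
  -- In degree zero `x` is a scalar, so `x ⊗ k` and `k ⊗ x` coincide. In higher degrees the leftmost
  -- factor is left alone and the recursion acts on the rest.
  | 0 =>
    { toFun := leftTensor k
      map_add' := leftTensor_add_right k
      map_smul' := fun c x => leftTensor_smul_right c k x
      norm_map' := fun x => (norm_leftTensor k x).trans (by rw [hk, one_mul]) }
  | n + 1 => completionLTensor H (rightTensor k hk n)

theorem rightTensor_leftTensor (k : H) (hk : ‖k‖ = 1) (h : H) {n : ℕ}
    (x : (hilbertTensorPower H n).carrier) :
    rightTensor k hk (n + 1) (leftTensor h x) = leftTensor h (rightTensor k hk n x) :=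
  completionLTensor_tmul (rightTensor k hk n) h x

/-- The components of `x ⊗ k` for `x` in the full Fock space. -/
def rightCreationFun (k : H) (hk : ‖k‖ = 1) (x : FullFock H) :
    (n : ℕ) → (hilbertTensorPower H n).carrier
  | 0 => 0
  | n + 1 => rightTensor k hk n (x n)

theorem hasSum_norm_rightCreationFun (k : H) (hk : ‖k‖ = 1) (x : FullFock H) :
    HasSum (fun n => ‖rightCreationFun k hk x n‖ ^ (2 : ENNReal).toReal)
      (‖x‖ ^ (2 : ENNReal).toReal) := by
  rw [← hasSum_nat_add_iff' 1]
  simp only [Finset.range_one, Finset.sum_singleton, rightCreationFun, norm_zero,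
    LinearIsometry.norm_map]
  simpa using lp.hasSum_norm (by norm_num) x

/-- The right creation operator `x ↦ x ⊗ k` on the full Fock space, for a unit vector `k`. -/
def rightCreation (k : H) (hk : ‖k‖ = 1) : FullFock H →L[ℂ] FullFock H :=
  LinearMap.mkContinuous
    { toFun := fun x =>
        (⟨rightCreationFun k hk x, memℓp_gen (hasSum_norm_rightCreationFun k hk x).summable⟩ :
          FullFock H)
      map_add' := fun x y => lp.ext (funext fun n => by
        cases n with
        | zero => exact (add_zero _).symm
        | succ n => exact map_add (rightTensor k hk n) (x n) (y n))
      map_smul' := fun c x => lp.ext (funext fun n => by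
        cases n with
        | zero => exact (smul_zero c).symm
        | succ n => exact map_smul (rightTensor k hk n) c (x n)) }
    1
    (fun x => by
      rw [one_mul]
      exact lp.norm_le_of_tsum_le (by norm_num) (norm_nonneg _)
        (hasSum_norm_rightCreationFun k hk x).tsum_eq.le)

theorem rightCreation_apply_zero (k : H) (hk : ‖k‖ = 1) (x : FullFock H) :
    (rightCreation k hk x : FullFock H) 0 = 0 := rfl

theorem rightCreation_apply_succ (k : H) (hk : ‖k‖ = 1) (x : FullFock H) (n : ℕ) :
    (rightCreation k hk x : FullFock H) (n + 1) = rightTensor k hk n (x n) := rfl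

theorem rightCreation_vacuum (k : H) (hk : ‖k‖ = 1) :
    rightCreation k hk (vacuum H) = degreeOne k := by
  refine lp.ext (funext fun n => ?_)
  rw [degreeOne_apply]
  cases n with
  | zero => rfl
  | succ n =>
    rw [rightCreation_apply_succ, creation_apply_succ]
    cases n with
    | zero => rfl
    | succ n =>
      have : (vacuum H : FullFock H) (n + 1) = 0 := lp.single_apply_ne _ _ _ (by omega)
      rw [this, map_zero]
      have := leftTensor_smul_right (0 : ℂ) k (0 : (hilbertTensorPower H (n + 1)).carrier)
      rw [zero_smul, zero_smul] at this
      exact this.symm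

theorem rightCreation_creation (k : H) (hk : ‖k‖ = 1) (h : H) (x : FullFock H) :
    rightCreation k hk (creation h x) = creation h (rightCreation k hk x) := by
  refine lp.ext (funext fun n => ?_)
  cases n with
  | zero => rfl
  | succ n =>
    rw [rightCreation_apply_succ, creation_apply_succ]
    cases n with
    | zero =>
      rw [creation_apply_zero, map_zero, rightCreation_apply_zero]
      have := leftTensor_smul_right (0 : ℂ) h (0 : (hilbertTensorPower H 0).carrier)
      rw [zero_smul, zero_smul] at this
      exact this.symm
    | succ n =>
      rw [creation_apply_succ, rightCreation_apply_succ, rightTensor_leftTensor]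

/-- Removing a factor on the left and adding one on the right act at opposite ends, so they commute
except on the vacuum, where the factor removed is the one just added. This produces the rank-one
defect; by `fullFock_ext` it suffices to check it on `Ω` and on vectors `h ⊗ x`. -/
theorem adjoint_creation_rightCreation (k : H) (hk : ‖k‖ = 1) (h : H) (x : FullFock H) :
    ContinuousLinearMap.adjoint (creation h) (rightCreation k hk x) =
      rightCreation k hk (ContinuousLinearMap.adjoint (creation h) x) +
        (⟪h, k⟫_ℂ * ⟪vacuum H, x⟫_ℂ) • vacuum H := by
  have key : ContinuousLinearMap.adjoint (creation h) ∘L rightCreation k hk =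
      rightCreation k hk ∘L ContinuousLinearMap.adjoint (creation h) +
        (⟪h, k⟫_ℂ • innerSL ℂ (vacuum H)).smulRight (vacuum H) := by
    refine fullFock_ext ?_ fun m z => ?_
    · simp [rightCreation_vacuum, degreeOne_apply, adjoint_creation_creation,
        adjoint_creation_vacuum, inner_self_eq_norm_sq_to_K, norm_vacuum]
    · simp [rightCreation_creation, adjoint_creation_creation, inner_vacuum_creation]
  simpa using DFunLike.congr_fun key x

/-- The adjoint form of the preceding relation; the defect is again supported on the vacuum. -/
theorem adjoint_rightCreation_creation (k : H) (hk : ‖k‖ = 1) (h : H) (x : FullFock H) :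
    ContinuousLinearMap.adjoint (rightCreation k hk) (creation h x) =
      creation h (ContinuousLinearMap.adjoint (rightCreation k hk) x) +
        (⟪k, h⟫_ℂ * ⟪vacuum H, x⟫_ℂ) • vacuum H := by
  refine ext_inner_right ℂ fun y => ?_
  rw [ContinuousLinearMap.adjoint_inner_left, ← ContinuousLinearMap.adjoint_inner_right,
    adjoint_creation_rightCreation, inner_add_right, inner_add_left, inner_smul_left,
    inner_smul_right, ← ContinuousLinearMap.adjoint_inner_left (rightCreation k hk),
    ContinuousLinearMap.adjoint_inner_right (creation h)]
  simp only [map_mul, inner_conj_symm]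
  ring

theorem adjoint_rightCreation_adjoint_creation (k : H) (hk : ‖k‖ = 1) (h : H) (x : FullFock H) :
    ContinuousLinearMap.adjoint (rightCreation k hk) (ContinuousLinearMap.adjoint (creation h) x) =
      ContinuousLinearMap.adjoint (creation h)
        (ContinuousLinearMap.adjoint (rightCreation k hk) x) := by
  refine ext_inner_right ℂ fun y => ?_
  simp only [ContinuousLinearMap.adjoint_inner_left, rightCreation_creation]

end RightCreation

/-! ## Operator matrices -/

section MatrixOperator

variable {H K : Type*} [NormedAddCommGroup H] [InnerProductSpace ℂ H]
    [NormedAddCommGroup K] [InnerProductSpace ℂ K] {n : ℕ}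

theorem matrixOperator_apply (a : Matrix (Fin n) (Fin n) (H →L[ℂ] K))
    (ζ : PiLp 2 (fun _ : Fin n => H)) (i : Fin n) :
    matrixOperator a ζ i = ∑ j, a i j (ζ j) := by
  simp [matrixOperator]

theorem norm_sq_matrixOperator_apply (a : Matrix (Fin n) (Fin n) (H →L[ℂ] K))
    (ζ : PiLp 2 (fun _ : Fin n => H)) :
    ‖matrixOperator a ζ‖ ^ 2 = ∑ i, ‖∑ j, a i j (ζ j)‖ ^ 2 := by
  simp only [PiLp.norm_sq_eq_of_L2, matrixOperator_apply]

theorem sum_norm_sq_le_norm_matrixOperator (a : Matrix (Fin n) (Fin n) (H →L[ℂ] K))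
    (ζ : Fin n → H) :
    ∑ i, ‖∑ j, a i j (ζ j)‖ ^ 2 ≤ ‖matrixOperator a‖ ^ 2 * ∑ j, ‖ζ j‖ ^ 2 := by
  have h1 := (matrixOperator a).le_opNorm (WithLp.toLp 2 ζ)
  have h2 := pow_le_pow_left₀ (norm_nonneg _) h1 2
  rwa [mul_pow, norm_sq_matrixOperator_apply, PiLp.norm_sq_eq_of_L2] at h2

theorem norm_matrixOperator_le (a : Matrix (Fin n) (Fin n) (H →L[ℂ] K)) {C : ℝ} (hC : 0 ≤ C)
    (h : ∀ ζ : Fin n → H, ∑ i, ‖∑ j, a i j (ζ j)‖ ^ 2 ≤ C ^ 2 * ∑ j, ‖ζ j‖ ^ 2) :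
    ‖matrixOperator a‖ ≤ C := by
  refine ContinuousLinearMap.opNorm_le_bound _ hC fun ζ => ?_
  refine le_of_sq_le_sq ?_ (by positivity)
  rw [mul_pow, norm_sq_matrixOperator_apply, PiLp.norm_sq_eq_of_L2]
  exact h _

theorem norm_matrixOperator_add_le (a c : Matrix (Fin n) (Fin n) (H →L[ℂ] K)) :
    ‖matrixOperator (a + c)‖ ≤ ‖matrixOperator a‖ + ‖matrixOperator c‖ := by
  have : matrixOperator (a + c) = matrixOperator a + matrixOperator c := by
    ext ζ i
    simp [matrixOperator_apply, Finset.sum_add_distrib]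
  rw [this]
  exact ContinuousLinearMap.opNorm_add_le _ _

/-- Multiplication with contractions on both sides is completely contractive. -/
theorem norm_matrixOperator_comp_le {H' K' : Type*} [NormedAddCommGroup H']
    [InnerProductSpace ℂ H'] [NormedAddCommGroup K'] [InnerProductSpace ℂ K']
    (a : Matrix (Fin n) (Fin n) (H →L[ℂ] K)) (c : Matrix (Fin n) (Fin n) (H' →L[ℂ] K'))
    (S : K →L[ℂ] K') (R : H' →L[ℂ] H) (hS : ∀ x, ‖S x‖ ≤ ‖x‖) (hR : ∀ x, ‖R x‖ ≤ ‖x‖)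
    (h : ∀ i j x, c i j x = S (a i j (R x))) :
    ‖matrixOperator c‖ ≤ ‖matrixOperator a‖ := by
  refine norm_matrixOperator_le _ (ContinuousLinearMap.opNorm_nonneg _) fun ζ => ?_
  calc ∑ i, ‖∑ j, c i j (ζ j)‖ ^ 2 ≤ ∑ i, ‖∑ j, a i j (R (ζ j))‖ ^ 2 := by
        refine Finset.sum_le_sum fun i _ => ?_
        simp only [h, ← map_sum]
        gcongr
        exact hS _
    _ ≤ ‖matrixOperator a‖ ^ 2 * ∑ j, ‖R (ζ j)‖ ^ 2 := sum_norm_sq_le_norm_matrixOperator a _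
    _ ≤ _ := by
        gcongr with j
        exact hR _

theorem adjoint_matrixOperator [CompleteSpace H] [CompleteSpace K]
    (a : Matrix (Fin n) (Fin n) (H →L[ℂ] K)) :
    ContinuousLinearMap.adjoint (matrixOperator a) =
      matrixOperator (Matrix.of fun i j => ContinuousLinearMap.adjoint (a j i)) := by
  symm
  rw [ContinuousLinearMap.eq_adjoint_iff]
  intro x y
  simp only [PiLp.inner_apply, matrixOperator_apply, sum_inner, inner_sum, Matrix.of_apply,
    ContinuousLinearMap.adjoint_inner_left]
  exact Finset.sum_comm

theorem norm_matrixOperator_adjoint [CompleteSpace H] [CompleteSpace K]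
    (a : Matrix (Fin n) (Fin n) (H →L[ℂ] K)) (c : Matrix (Fin n) (Fin n) (K →L[ℂ] H))
    (h : ∀ i j, c i j = ContinuousLinearMap.adjoint (a j i)) :
    ‖matrixOperator c‖ = ‖matrixOperator a‖ := by
  have : c = Matrix.of fun i j => ContinuousLinearMap.adjoint (a j i) := by
    ext1 i j
    exact h i j
  rw [this, ← adjoint_matrixOperator, LinearIsometryEquiv.norm_map]

/-- Compression of an operator matrix to an operator by a column and a row of scalars. -/
theorem norm_sum_smul_le_norm_matrixOperator (a : Matrix (Fin n) (Fin n) (H →L[ℂ] K))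
    (α β : Fin n → ℂ) :
    ‖∑ k, ∑ l, (β k * α l) • a k l‖ ≤
      √(∑ k, ‖β k‖ ^ 2) * ‖matrixOperator a‖ * √(∑ l, ‖α l‖ ^ 2) := by
  refine ContinuousLinearMap.opNorm_le_bound _ (by positivity) fun x => ?_
  have h1 : (∑ k, ∑ l, (β k * α l) • a k l) x = ∑ k, β k • ∑ l, a k l (α l • x) := by
    simp [mul_smul, Finset.smul_sum]
  have h2 := sum_norm_sq_le_norm_matrixOperator a (fun l => α l • x)
  simp only [norm_smul, mul_pow, ← Finset.sum_mul] at h2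
  rw [h1]
  calc ‖∑ k, β k • ∑ l, a k l (α l • x)‖ ≤ ∑ k, ‖β k‖ * ‖∑ l, a k l (α l • x)‖ :=
        (norm_sum_le _ _).trans_eq (by simp only [norm_smul])
    _ ≤ √(∑ k, ‖β k‖ ^ 2) * √(∑ k, ‖∑ l, a k l (α l • x)‖ ^ 2) :=
        Real.sum_mul_le_sqrt_mul_sqrt _ _ _
    _ ≤ √(∑ k, ‖β k‖ ^ 2) * √(‖matrixOperator a‖ ^ 2 * ((∑ l, ‖α l‖ ^ 2) * ‖x‖ ^ 2)) := by
        gcongr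
    _ = _ := by
        rw [Real.sqrt_mul (by positivity), Real.sqrt_mul (by positivity),
          Real.sqrt_sq (ContinuousLinearMap.opNorm_nonneg _),
          Real.sqrt_sq (norm_nonneg _)]
        ring

end MatrixOperator

theorem exists_norm_apply_le {E : Type*} [NormedAddCommGroup E] [NormedSpace ℂ E]
    (f : NormedDual E) : ∃ M : ℝ, 0 ≤ M ∧ ∀ x, ‖f x‖ ≤ M * ‖x‖ :=
  ⟨‖f‖, norm_nonneg f, f.le_opNorm⟩

/-- Finite matrices of bounded functionals on a space of operators are completely bounded. -/
theorem norm_matrix_functional_le {K : Type*} [NormedAddCommGroup K] [InnerProductSpace ℂ K]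
    (V : Submodule ℂ (K →L[ℂ] K)) {n m : ℕ} (f : Matrix (Fin n) (Fin n) (NormedDual V))
    (M : Matrix (Fin n) (Fin n) ℝ) (hM : ∀ i j, 0 ≤ M i j)
    (hf : ∀ i j x, ‖f i j x‖ ≤ M i j * ‖(x : K →L[ℂ] K)‖) (x : Matrix (Fin m) (Fin m) V) :
    ‖Matrix.toEuclideanCLM (𝕜 := ℂ) (n := Fin n × Fin m)
      (Matrix.of fun p q => f p.1 q.1 (x p.2 q.2))‖ ≤
      (∑ i, ∑ j, M i j) * (MatrixNorms.operators K K).sub V m x := by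
  have hν : (MatrixNorms.operators K K).sub V m x = ‖matrixOperator (x.map V.subtype)‖ := rfl
  rw [hν]
  have hx : 0 ≤ ‖matrixOperator (x.map V.subtype)‖ := ContinuousLinearMap.opNorm_nonneg _
  have hM' : 0 ≤ ∑ i, ∑ j, M i j :=
    Finset.sum_nonneg fun i _ => Finset.sum_nonneg fun j _ => hM i j
  refine ContinuousLinearMap.opNorm_le_of_re_inner_le (by positivity) fun α β hα hβ => ?_
  rw [← inner_conj_symm, RCLike.conj_re]
  refine (RCLike.re_le_norm _).trans ?_
  -- The sesquilinear form splits into `n²` terms, each a single functional `f i j` evaluated at the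
  -- compression of `x` by the blocks `β (i, ·)` and `α (j, ·)`, whose norms are at most 1.
  have h1 : ⟪β, Matrix.toEuclideanCLM (𝕜 := ℂ) (n := Fin n × Fin m)
      (Matrix.of fun p q => f p.1 q.1 (x p.2 q.2)) α⟫_ℂ =
      ∑ i, ∑ j, f i j (∑ k, ∑ l, (starRingEnd ℂ (β (i, k)) * α (j, l)) • x k l) := by
    simp only [PiLp.inner_apply, Matrix.ofLp_toEuclideanCLM, Matrix.mulVec, dotProduct,
      Matrix.of_apply, map_sum, map_smul, Fintype.sum_prod_type, RCLike.inner_apply,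
      Finset.sum_mul, smul_eq_mul]
    refine Finset.sum_congr rfl fun i _ => ?_
    rw [Finset.sum_comm]
    refine Finset.sum_congr rfl fun j _ => Finset.sum_congr rfl fun k _ =>
      Finset.sum_congr rfl fun l _ => ?_
    ring
  have hle : ∀ (γ : EuclideanSpace ℂ (Fin n × Fin m)) (i : Fin n),
      √(∑ k, ‖γ (i, k)‖ ^ 2) ≤ ‖γ‖ := by
    intro γ i
    rw [EuclideanSpace.norm_eq, Fintype.sum_prod_type]
    refine Real.sqrt_le_sqrt ?_
    exact Finset.single_le_sum (f := fun i => ∑ k, ‖γ (i, k)‖ ^ 2) (fun _ _ => by positivity)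
      (Finset.mem_univ i)
  rw [h1]
  calc _ ≤ ∑ i, ∑ j, M i j * (‖β‖ * ‖matrixOperator (x.map V.subtype)‖ * ‖α‖) := by
        refine (norm_sum_le _ _).trans (Finset.sum_le_sum fun i _ => ?_)
        refine (norm_sum_le _ _).trans (Finset.sum_le_sum fun j _ => ?_)
        refine (hf i j _).trans ?_
        refine mul_le_mul_of_nonneg_left ?_ (hM i j)
        have h2 := norm_sum_smul_le_norm_matrixOperator (x.map V.subtype)
          (fun l => α (j, l)) (fun k => starRingEnd ℂ (β (i, k)))
        have h3 : ‖((∑ k, ∑ l, (starRingEnd ℂ (β (i, k)) * α (j, l)) • x k l : V) : K →L[ℂ] K)‖ =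
            ‖∑ k, ∑ l, (starRingEnd ℂ (β (i, k)) * α (j, l)) • (x.map V.subtype) k l‖ := by
          simp
        rw [h3]
        refine h2.trans ?_
        simp only [RCLike.norm_conj]
        gcongr
        · exact hle β i
        · exact hle α j
    _ = _ := by
        rw [hα, hβ]
        simp only [← Finset.sum_mul]
        ring

/-! ## Matrices of creation operators -/

section CreationMatrix

variable {H : Type u} [NormedAddCommGroup H] [InnerProductSpace ℂ H]

/-- By `inner_creation`, orthonormality of the `w k` makes the vectors `ℓ(v k) (w k)` pairwise
orthogonal, of norm `‖v k‖`. -/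
theorem norm_sq_sum_creation {ι : Type*} [Fintype ι] (v : ι → H) {w : ι → FullFock H}
    (hw : Orthonormal ℂ w) : ‖∑ k, creation (v k) (w k)‖ ^ 2 = ∑ k, ‖v k‖ ^ 2 := by
  classical
  have h1 : ⟪∑ k, creation (v k) (w k), ∑ k, creation (v k) (w k)⟫_ℂ =
      ∑ k, ⟪v k, v k⟫_ℂ := by
    simp only [sum_inner, inner_sum, inner_creation, orthonormal_iff_ite.1 hw]
    simp
  simp only [inner_self_eq_norm_sq_to_K] at h1
  exact_mod_cast h1

/-- The norm of a matrix of creation operators is at most its norm in the column space. -/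
theorem norm_matrixOperator_creation_le {n : ℕ} (h : Matrix (Fin n) (Fin n) H) :
    ‖matrixOperator (Matrix.of fun i j => (creation (h i j) : FullFock H →L[ℂ] FullFock H))‖ ≤
      ‖matrixOperator (Matrix.of fun i j => ContinuousLinearMap.toSpanSingleton ℂ (h i j))‖ := by
  refine norm_matrixOperator_le _ (ContinuousLinearMap.opNorm_nonneg _) fun ζ => ?_
  -- Expanding the finitely many `ζ j` in an orthonormal basis of their span reduces the estimate to
  -- scalar coefficients.
  let S := Submodule.span ℂ (Set.range ζ)
  have : FiniteDimensional ℂ S := FiniteDimensional.span_of_finite ℂ (Set.finite_range ζ)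
  let w := stdOrthonormalBasis ℂ S
  have hw : Orthonormal ℂ fun k => (w k : FullFock H) :=
    w.orthonormal.comp_linearIsometry S.subtypeₗᵢ
  let z : Fin n → S := fun j => ⟨ζ j, Submodule.subset_span ⟨j, rfl⟩⟩
  let c : Fin n → Fin (Module.finrank ℂ S) → ℂ := fun j k => w.repr (z j) k
  have hz : ∀ j, ζ j = ∑ k, c j k • (w k : FullFock H) := by
    intro j
    have := congrArg (Subtype.val) (w.sum_repr (z j))
    rw [← show (z j : FullFock H) = ζ j from rfl, ← this]
    simp [c]
  have hnorm : ∀ j, ‖ζ j‖ ^ 2 = ∑ k, ‖c j k‖ ^ 2 := by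
    intro j
    have : ‖ζ j‖ = ‖w.repr (z j)‖ := by
      rw [LinearIsometryEquiv.norm_map]
      rfl
    rw [this, EuclideanSpace.norm_sq_eq]
  have hsum : ∀ i, ‖∑ j, creation (h i j) (ζ j)‖ ^ 2 = ∑ k, ‖∑ j, c j k • h i j‖ ^ 2 := by
    intro i
    rw [← norm_sq_sum_creation (fun k => ∑ j, c j k • h i j) hw]
    congr 2
    simp only [hz, map_sum, map_smul, sum_apply,
      smul_apply]
    exact Finset.sum_comm
  simp only [Matrix.of_apply, hsum, hnorm]
  -- With the sum over the basis index `k` outermost, each term is the column estimate applied to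
  -- the scalar vector `(c j k)_j`.
  rw [Finset.sum_comm, Finset.sum_comm (s := Finset.univ (α := Fin n)), Finset.mul_sum]
  refine Finset.sum_le_sum fun k _ => ?_
  simpa using sum_norm_sq_le_norm_matrixOperator
    (Matrix.of fun i j => ContinuousLinearMap.toSpanSingleton ℂ (h i j)) (fun j => c j k)

/-- The norm of a matrix of annihilation operators is at most its norm in the row space. -/
theorem norm_matrixOperator_adjoint_creation_le [CompleteSpace H] {n : ℕ}
    (h : Matrix (Fin n) (Fin n) H) :
    ‖matrixOperator (Matrix.of fun i j =>
      ContinuousLinearMap.adjoint (creation (h i j) : FullFock H →L[ℂ] FullFock H))‖ ≤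
      ‖matrixOperator (Matrix.of fun i j => innerSL ℂ (h i j))‖ := by
  have h1 : ‖matrixOperator (Matrix.of fun i j =>
      ContinuousLinearMap.adjoint (creation (h i j) : FullFock H →L[ℂ] FullFock H))‖ =
      ‖matrixOperator (Matrix.of fun i j =>
        (creation (h.transpose i j) : FullFock H →L[ℂ] FullFock H))‖ :=
    norm_matrixOperator_adjoint _ _ fun i j => rfl
  have h2 : ‖matrixOperator (Matrix.of fun i j => innerSL ℂ (h i j))‖ =
      ‖matrixOperator (Matrix.of fun i j =>
        ContinuousLinearMap.toSpanSingleton ℂ (h.transpose i j))‖ := by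
    refine norm_matrixOperator_adjoint _ _ fun i j => ?_
    rw [ContinuousLinearMap.eq_adjoint_iff]
    intro x y
    simp [inner_smul_right]
  rw [h1, h2]
  exact norm_matrixOperator_creation_le h.transpose

end CreationMatrix

/-! ## The coefficients of an operator on the full Fock space -/

section BasisIsometry

variable {I : Type*} {J : Type*} {H : Type u} [NormedAddCommGroup H] [InnerProductSpace ℂ H]
  [CompleteSpace H]

/-- The isometry of `ℓ²(I)` onto the closed span of the part `(b (σ i))` of a Hilbert basis. -/
def basisIsometry (b : HilbertBasis J ℂ H) {σ : I → J} (hσ : Function.Injective σ) :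
    lp (fun _ : I => ℂ) 2 →ₗᵢ[ℂ] H :=
  (b.orthonormal.comp σ hσ).orthogonalFamily.linearIsometry

variable (b : HilbertBasis J ℂ H) {σ : I → J} (hσ : Function.Injective σ)

theorem basisIsometry_single [DecidableEq I] (i : I) (c : ℂ) :
    basisIsometry b hσ (lp.single 2 i c) = c • b (σ i) :=
  (OrthogonalFamily.linearIsometry_apply_single _ _).trans (by simp)

theorem inner_basisIsometry (i : I) (t : lp (fun _ : I => ℂ) 2) :
    ⟪b (σ i), basisIsometry b hσ t⟫_ℂ = t i := by
  classical
  have h1 : b (σ i) = basisIsometry b hσ (lp.single 2 i 1) := by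
    rw [basisIsometry_single, one_smul]
  rw [h1, LinearIsometry.inner_map_map, lp.inner_single_left]
  simp

/-- The coefficients of a vector with respect to a part of a Hilbert basis. -/
def basisCoefficients : H →L[ℂ] lp (fun _ : I => ℂ) 2 :=
  ContinuousLinearMap.adjoint (basisIsometry b hσ).toContinuousLinearMap

theorem inner_basisCoefficients_right (t : lp (fun _ : I => ℂ) 2) (h : H) :
    ⟪t, basisCoefficients b hσ h⟫_ℂ = ⟪basisIsometry b hσ t, h⟫_ℂ :=
  ContinuousLinearMap.adjoint_inner_right _ _ _

theorem inner_basisCoefficients_left (t : lp (fun _ : I => ℂ) 2) (h : H) :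
    ⟪basisCoefficients b hσ h, t⟫_ℂ = ⟪h, basisIsometry b hσ t⟫_ℂ :=
  ContinuousLinearMap.adjoint_inner_left _ _ _

theorem basisCoefficients_apply (h : H) (i : I) :
    basisCoefficients b hσ h i = ⟪b (σ i), h⟫_ℂ := by
  classical
  have h1 := inner_basisCoefficients_right b hσ (lp.single 2 i 1) h
  rw [lp.inner_single_left, basisIsometry_single, one_smul] at h1
  simpa using h1

theorem basisCoefficients_basisIsometry (t : lp (fun _ : I => ℂ) 2) :
    basisCoefficients b hσ (basisIsometry b hσ t) = t :=
  lp.ext (funext fun i => by rw [basisCoefficients_apply, inner_basisIsometry])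

theorem norm_adjoint_apply_le_of_isometry {E F : Type*} [NormedAddCommGroup E]
    [InnerProductSpace ℂ E] [CompleteSpace E] [NormedAddCommGroup F] [InnerProductSpace ℂ F]
    [CompleteSpace F] (A : E →L[ℂ] F) (hA : ∀ x, ‖A x‖ = ‖x‖) (y : F) :
    ‖ContinuousLinearMap.adjoint A y‖ ≤ ‖y‖ := by
  have h1 : ‖A‖ ≤ 1 := A.opNorm_le_bound zero_le_one fun x => by rw [hA, one_mul]
  rw [← LinearIsometryEquiv.norm_map ContinuousLinearMap.adjoint A] at h1
  exact ((ContinuousLinearMap.adjoint A).le_of_opNorm_le h1 y).trans (one_mul _).le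

theorem norm_basisCoefficients_le (h : H) : ‖basisCoefficients b hσ h‖ ≤ ‖h‖ :=
  norm_adjoint_apply_le_of_isometry _ (fun x => (basisIsometry b hσ).norm_map x) h

theorem norm_adjoint_degreeOne_le (x : FullFock H) :
    ‖ContinuousLinearMap.adjoint degreeOne x‖ ≤ ‖x‖ :=
  norm_adjoint_apply_le_of_isometry _ norm_degreeOne_apply x

/-- With `V` the basis isometry, the projection becomes `V V*` on `H`. It is enough to test against
basis vectors: those in the family are fixed by the projection, the others are orthogonal to its
range. -/
theorem adjoint_degreeOne_degreeOneProjection (x : FullFock H) :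
    ContinuousLinearMap.adjoint degreeOne (degreeOneProjection (fun i => b (σ i)) x) =
      basisIsometry b hσ (basisCoefficients b hσ (ContinuousLinearMap.adjoint degreeOne x)) := by
  refine b.repr.injective (lp.ext (funext fun j => ?_))
  rw [b.repr_apply_apply, b.repr_apply_apply, ContinuousLinearMap.adjoint_inner_right,
    degreeOneProjection, ← Submodule.inner_starProjection_left_eq_right]
  by_cases hj : ∃ i, σ i = j
  · obtain ⟨i, rfl⟩ := hj
    rw [inner_basisIsometry, basisCoefficients_apply, ContinuousLinearMap.adjoint_inner_right,
      Submodule.starProjection_eq_self_iff.2]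
    exact Submodule.le_topologicalClosure _ (Submodule.subset_span ⟨i, rfl⟩)
  · have hne : ∀ i, σ i ≠ j := fun i h => hj ⟨i, h⟩
    have h1 : basisCoefficients b hσ (b j) = 0 := lp.ext (funext fun i => by
      rw [basisCoefficients_apply]
      exact b.orthonormal.inner_eq_zero (hne i))
    rw [← inner_basisCoefficients_left, h1, inner_zero_left,
      (Submodule.starProjection_apply_eq_zero_iff _).2, inner_zero_left]
    rw [Submodule.orthogonal_closure, Submodule.mem_orthogonal]
    intro y hy
    induction hy using Submodule.span_induction with
    | mem y hy =>
      obtain ⟨i, rfl⟩ := hy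
      exact (inner_degreeOne _ _).trans (b.orthonormal.inner_eq_zero (hne i))
    | zero => exact inner_zero_left _
    | add y z _ _ hy hz => rw [inner_add_left, hy, hz, add_zero]
    | smul c y _ hy => rw [inner_smul_left, hy, mul_zero]

end BasisIsometry

section Coefficients

variable {I : Type v} {H : Type u} [NormedAddCommGroup H] [InnerProductSpace ℂ H] [CompleteSpace H]
  (b : HilbertBasis (I ⊕ I) ℂ H)

/-- The coefficients of `T Ω` with respect to the `e_i`, and the conjugates of the coefficients of
`T* Ω` with respect to the `e'_i`. -/
def circularCoefficients : (FullFock H →L[ℂ] FullFock H) →ₗ[ℂ]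
    lp (fun _ : I => ℂ) 2 × lp (fun _ : I => ℂ) 2 where
  -- `T ↦ T*Ω` is antilinear; the `star` restores linearity.
  toFun T :=
    (basisCoefficients b Sum.inl_injective (ContinuousLinearMap.adjoint degreeOne (T (vacuum H))),
      star (basisCoefficients b Sum.inr_injective (ContinuousLinearMap.adjoint degreeOne
        (ContinuousLinearMap.adjoint T (vacuum H)))))
  map_add' S T := by simp
  map_smul' c T := by
    rw [map_smulₛₗ ContinuousLinearMap.adjoint c T]
    simp

/-- The operator `ℓ(∑ t_i e_i) + ℓ(∑ s̄_i e'_i)*` with coefficients `(t, s)`. -/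
def circularSynthesis : lp (fun _ : I => ℂ) 2 × lp (fun _ : I => ℂ) 2 →ₗ[ℂ]
    (FullFock H →L[ℂ] FullFock H) where
  toFun p := creation (basisIsometry b Sum.inl_injective p.1) +
    ContinuousLinearMap.adjoint (creation (basisIsometry b Sum.inr_injective (star p.2)))
  map_add' p q := by
    simp only [Prod.fst_add, Prod.snd_add, star_add, map_add]
    abel
  map_smul' c p := by
    simp only [Prod.smul_fst, Prod.smul_snd, star_smul, map_smul, RingHom.id_apply, smul_add]
    rw [map_smulₛₗ ContinuousLinearMap.adjoint (star c)]
    simp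

theorem circularCoefficients_fst (T : FullFock H →L[ℂ] FullFock H) :
    (circularCoefficients b T).1 =
      basisCoefficients b Sum.inl_injective
        (ContinuousLinearMap.adjoint degreeOne (T (vacuum H))) := rfl

theorem circularCoefficients_snd (T : FullFock H →L[ℂ] FullFock H) :
    (circularCoefficients b T).2 =
      star (basisCoefficients b Sum.inr_injective (ContinuousLinearMap.adjoint degreeOne
        (ContinuousLinearMap.adjoint T (vacuum H)))) := rfl

theorem circularSynthesis_apply (p : lp (fun _ : I => ℂ) 2 × lp (fun _ : I => ℂ) 2) :
    circularSynthesis b p = creation (basisIsometry b Sum.inl_injective p.1) +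
    ContinuousLinearMap.adjoint (creation (basisIsometry b Sum.inr_injective (star p.2))) := rfl

theorem continuous_circularCoefficients : Continuous (circularCoefficients b) := by
  have h1 : Continuous fun T : FullFock H →L[ℂ] FullFock H => T (vacuum H) :=
    (ContinuousLinearMap.apply ℂ (FullFock H) (vacuum H)).continuous
  have h2 : Continuous fun T : FullFock H →L[ℂ] FullFock H => ContinuousLinearMap.adjoint T :=
    ContinuousLinearMap.adjoint.continuous
  refine Continuous.prodMk ?_ (Continuous.star ?_)
  · exact (basisCoefficients b Sum.inl_injective).continuous.comp
      ((ContinuousLinearMap.adjoint degreeOne).continuous.comp h1)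
  · exact (basisCoefficients b Sum.inr_injective).continuous.comp
      ((ContinuousLinearMap.adjoint degreeOne).continuous.comp (h1.comp h2))

theorem continuous_circularSynthesis : Continuous (circularSynthesis b) := by
  refine Continuous.add ?_ ?_
  · exact creation.continuous.comp ((basisIsometry b Sum.inl_injective).continuous.comp
      continuous_fst)
  · exact ContinuousLinearMap.adjoint.continuous.comp (creation.continuous.comp
      ((basisIsometry b Sum.inr_injective).continuous.comp continuous_snd.star))

/-- Annihilation operators kill the vacuum, so the operator applied to `Ω` shows only its creation
part, and its adjoint applied to `Ω` only the other part. -/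
theorem circularCoefficients_circularSynthesis
    (p : lp (fun _ : I => ℂ) 2 × lp (fun _ : I => ℂ) 2) :
    circularCoefficients b (circularSynthesis b p) = p := by
  refine Prod.ext ?_ ?_
  · rw [circularCoefficients_fst, circularSynthesis_apply, add_apply,
      adjoint_creation_vacuum, add_zero, ← degreeOne_apply, adjoint_degreeOne_degreeOne,
      basisCoefficients_basisIsometry]
  · rw [circularCoefficients_snd, circularSynthesis_apply, map_add,
      ContinuousLinearMap.adjoint_adjoint, add_apply, adjoint_creation_vacuum,
      zero_add, ← degreeOne_apply, adjoint_degreeOne_degreeOne, basisCoefficients_basisIsometry,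
      star_star]

/-- The factorisation through `ℓ²(I) × ℓ²(I)` on which every property of the projection rests. -/
theorem circularProjection_eq (T : FullFock H →L[ℂ] FullFock H) :
    circularProjection b T = circularSynthesis b (circularCoefficients b T) := by
  rw [circularProjection, creationOfDegreeOne, creationOfDegreeOne,
    adjoint_degreeOne_degreeOneProjection b Sum.inl_injective,
    adjoint_degreeOne_degreeOneProjection b Sum.inr_injective, circularSynthesis_apply,
    circularCoefficients_fst, circularCoefficients_snd, star_star]

theorem circularSynthesis_single [DecidableEq I] (ξ : I → ℝ) (i : I) (c : ℂ) :
    circularSynthesis b (lp.single 2 i c, lp.single 2 i ((ξ i : ℂ) * c)) =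
      c • circularCore b ξ i := by
  have h1 : star (lp.single 2 i ((ξ i : ℂ) * c) : lp (fun _ : I => ℂ) 2) =
      lp.single 2 i ((ξ i : ℂ) * starRingEnd ℂ c) := by
    refine lp.ext (funext fun j => ?_)
    rw [lp.star_apply]
    by_cases hj : j = i
    · subst hj
      simp
    · rw [lp.single_apply_ne _ _ _ hj, lp.single_apply_ne _ _ _ hj, star_zero]
  rw [circularSynthesis_apply, h1, basisIsometry_single, basisIsometry_single, circularCore,
    map_smul, map_smul, map_smulₛₗ ContinuousLinearMap.adjoint, smul_add, smul_smul]
  simp [mul_comm]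

/-! ### Complete boundedness -/

theorem circularCoefficients_fst_smul (T : FullFock H →L[ℂ] FullFock H) (c : ℂ) :
    c • (circularCoefficients b T).1 =
      basisCoefficients b Sum.inl_injective
        (ContinuousLinearMap.adjoint degreeOne (T (c • vacuum H))) := by
  rw [circularCoefficients_fst, map_smul, map_smul, map_smul]

/-- Exhibits the row coordinate as a compression of `T` itself, with no adjoint of `T`, as complete
contractivity requires. -/
theorem inner_star_circularCoefficients_snd (T : FullFock H →L[ℂ] FullFock H)
    (x : lp (fun _ : I => ℂ) 2) :
    ⟪star (circularCoefficients b T).2, x⟫_ℂ =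
      ⟪vacuum H, T (degreeOne (basisIsometry b Sum.inr_injective x))⟫_ℂ := by
  rw [circularCoefficients_snd, star_star, inner_basisCoefficients_left,
    ContinuousLinearMap.adjoint_inner_left, ContinuousLinearMap.adjoint_inner_left]

theorem cbNormLE_circularCoefficients :
    CBNormLE (MatrixNorms.operators (FullFock H) (FullFock H))
      ((MatrixNorms.column (lp (fun _ : I => ℂ) 2)).directSum (MatrixNorms.row I))
      (circularCoefficients b) 1 := by
  refine ⟨zero_le_one, fun n a => ?_⟩
  have hΩ : ∀ x : FullFock H, ‖innerSL ℂ (vacuum H) x‖ ≤ ‖x‖ := fun x => by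
    refine (norm_inner_le_norm (𝕜 := ℂ) (vacuum H) x).trans ?_
    rw [norm_vacuum, one_mul]
  have hD : ∀ x : FullFock H, ‖(basisCoefficients b Sum.inl_injective ∘L
      ContinuousLinearMap.adjoint degreeOne) x‖ ≤ ‖x‖ := fun x =>
    (norm_basisCoefficients_le b Sum.inl_injective _).trans (norm_adjoint_degreeOne_le x)
  have hS : ∀ x : ℂ, ‖ContinuousLinearMap.toSpanSingleton ℂ (vacuum H) x‖ ≤ ‖x‖ := fun x => by
    rw [ContinuousLinearMap.toSpanSingleton_apply, norm_smul, norm_vacuum, mul_one]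
  rw [one_mul]
  refine max_le ?_ ?_
  · exact norm_matrixOperator_comp_le a
      (Matrix.of fun i j =>
        ContinuousLinearMap.toSpanSingleton ℂ (circularCoefficients b (a i j)).1)
      (basisCoefficients b Sum.inl_injective ∘L ContinuousLinearMap.adjoint degreeOne)
      (ContinuousLinearMap.toSpanSingleton ℂ (vacuum H)) hD hS
      (fun i j x => circularCoefficients_fst_smul b (a i j) x)
  · exact norm_matrixOperator_comp_le a
      (Matrix.of fun i j => innerSL ℂ (star (circularCoefficients b (a i j)).2))
      (innerSL ℂ (vacuum H))
      (degreeOne ∘L (basisIsometry b Sum.inr_injective).toContinuousLinearMap) hΩ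
      (fun x => ((norm_degreeOne_apply _).trans
        ((basisIsometry b Sum.inr_injective).norm_map x)).le)
      (fun i j x => inner_star_circularCoefficients_snd b (a i j) x)

/-- The creation part is completely contractive on the column coordinate and the annihilation part
on the row coordinate; `2 = 1 + 1`. -/
theorem cbNormLE_circularSynthesis :
    CBNormLE ((MatrixNorms.column (lp (fun _ : I => ℂ) 2)).directSum (MatrixNorms.row I))
      (MatrixNorms.operators (FullFock H) (FullFock H)) (circularSynthesis b) 2 := by
  refine ⟨zero_le_two, fun n a => ?_⟩
  rw [two_mul]
  refine (norm_matrixOperator_add_le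
    (Matrix.of fun i j => creation (basisIsometry b Sum.inl_injective (a i j).1))
    (Matrix.of fun i j => ContinuousLinearMap.adjoint
      (creation (basisIsometry b Sum.inr_injective (star (a i j).2))))).trans (add_le_add ?_ ?_)
  · refine (norm_matrixOperator_creation_le
      (Matrix.of fun i j => basisIsometry b Sum.inl_injective (a i j).1)).trans
      (le_trans ?_ (le_max_left _ _))
    refine norm_matrixOperator_comp_le _ _
      (basisIsometry b Sum.inl_injective).toContinuousLinearMap (ContinuousLinearMap.id ℂ ℂ)
      (fun x => ((basisIsometry b Sum.inl_injective).norm_map x).le) (fun x => le_rfl)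
      (fun i j x => ?_)
    simp
  · refine (norm_matrixOperator_adjoint_creation_le
      (Matrix.of fun i j => basisIsometry b Sum.inr_injective (star (a i j).2))).trans
      (le_trans ?_ (le_max_right _ _))
    refine norm_matrixOperator_comp_le _ _ (ContinuousLinearMap.id ℂ ℂ)
      (basisCoefficients b Sum.inr_injective) (fun x => le_rfl)
      (norm_basisCoefficients_le b Sum.inr_injective) (fun i j x => ?_)
    simp [inner_basisCoefficients_right]

end Coefficients

/-! ## The von Neumann algebra generated by the circular elements -/

section CircularAlgebra

variable {I : Type v} {H : Type u} [NormedAddCommGroup H] [InnerProductSpace ℂ H]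
  (b : HilbertBasis (I ⊕ I) ℂ H)

theorem mem_graph_diagonalOperator {ξ : I → ℝ}
    {p : lp (fun _ : I => ℂ) 2 × lp (fun _ : I => ℂ) 2} :
    p ∈ (diagonalOperator ξ).graph ↔ ∀ i, p.2 i = (ξ i : ℂ) * p.1 i := by
  rw [LinearPMap.mem_graph_iff]
  constructor
  · rintro ⟨y, hy1, hy2⟩ i
    rw [← hy2, ← hy1]
    rfl
  · intro h
    -- The domain condition is automatic, since `p.2` is already square summable.
    have hmem : Memℓp (fun i => (ξ i : ℂ) * p.1 i) 2 := by
      rw [← funext h]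
      exact lp.memℓp p.2
    exact ⟨⟨p.1, hmem⟩, rfl, lp.ext (funext fun i => (h i).symm)⟩

/-- `r(e'_i) + ξ_i r(e_i)*`, where `r` denotes right creation operators. -/
def rightCircularCore (ξ : I → ℝ) (i : I) : FullFock H →L[ℂ] FullFock H :=
  rightCreation (b (Sum.inr i)) (b.orthonormal.1 _) +
    (ξ i : ℂ) • ContinuousLinearMap.adjoint
      (rightCreation (b (Sum.inl i)) (b.orthonormal.1 _))

theorem adjoint_rightCreation_vacuum (k : H) (hk : ‖k‖ = 1) :
    ContinuousLinearMap.adjoint (rightCreation k hk) (vacuum H) = 0 := by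
  refine ext_inner_right ℂ fun y => ?_
  rw [ContinuousLinearMap.adjoint_inner_left, inner_vacuum, rightCreation_apply_zero,
    inner_zero_right, inner_zero_left]

theorem rightCircularCore_vacuum (ξ : I → ℝ) (i : I) :
    rightCircularCore b ξ i (vacuum H) = degreeOne (b (Sum.inr i)) := by
  rw [rightCircularCore, add_apply, smul_apply, adjoint_rightCreation_vacuum, smul_zero, add_zero,
    rightCreation_vacuum]

/-- Equivalently, the adjoint of the right circular element sends `Ω` to `ξ_i e_i`; this is where
the weight in the graph relation originates. -/
theorem inner_vacuum_rightCircularCore (ξ : I → ℝ) (i : I) (x : FullFock H) :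
    ⟪vacuum H, rightCircularCore b ξ i x⟫_ℂ = (ξ i : ℂ) * ⟪degreeOne (b (Sum.inl i)), x⟫_ℂ := by
  rw [rightCircularCore, add_apply, smul_apply, inner_add_right, inner_smul_right,
    ContinuousLinearMap.adjoint_inner_right, rightCreation_vacuum, inner_vacuum,
    rightCreation_apply_zero, inner_zero_right, zero_add]

theorem adjoint_circularCore (ξ : I → ℝ) (i : I) :
    ContinuousLinearMap.adjoint (circularCore b ξ i) =
      ContinuousLinearMap.adjoint (creation (b (Sum.inl i))) +
        (ξ i : ℂ) • creation (b (Sum.inr i)) := by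
  rw [circularCore, map_add, map_smulₛₗ ContinuousLinearMap.adjoint,
    ContinuousLinearMap.adjoint_adjoint, Complex.conj_ofReal]

/-- Only two pairs contribute vacuum defects: `ξ_j ℓ'_j*` with `r(e'_i)`, and `ℓ_j` with `ξ_i
r(e_i)*`. They lie on opposite sides of the commutator, so for `i = j` they cancel; for `i ≠ j`
orthogonality removes both. -/
theorem rightCircularCore_comm (ξ : I → ℝ) (i j : I) :
    circularCore b ξ j * rightCircularCore b ξ i =
      rightCircularCore b ξ i * circularCore b ξ j := by
  classical
  ext1 x
  simp only [mul_apply_eq_comp, circularCore, rightCircularCore, add_apply,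
    smul_apply, map_add, map_smul, adjoint_creation_rightCreation, adjoint_rightCreation_creation,
    adjoint_rightCreation_adjoint_creation, rightCreation_creation,
    orthonormal_iff_ite.1 b.orthonormal, Sum.inl.injEq, Sum.inr.injEq]
  by_cases hij : i = j
  · subst hij
    simp only [if_true, smul_add]
    abel
  · simp only [hij, Ne.symm hij, if_false, zero_mul, zero_smul, add_zero, smul_add,
      smul_comm (ξ i : ℂ) (ξ j : ℂ)]
    abel

/-- Here each possible defect pairs some `e` with some `e'`, so it vanishes by orthogonality. -/
theorem rightCircularCore_comm_adjoint (ξ : I → ℝ) (i j : I) :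
    ContinuousLinearMap.adjoint (circularCore b ξ j) * rightCircularCore b ξ i =
      rightCircularCore b ξ i * ContinuousLinearMap.adjoint (circularCore b ξ j) := by
  classical
  rw [adjoint_circularCore]
  ext1 x
  simp only [mul_apply_eq_comp, rightCircularCore, add_apply,
    smul_apply, map_add, map_smul, adjoint_creation_rightCreation, adjoint_rightCreation_creation,
    adjoint_rightCreation_adjoint_creation, rightCreation_creation,
    orthonormal_iff_ite.1 b.orthonormal, reduceCtorEq, if_false, zero_mul, zero_smul, add_zero,
    smul_add, smul_comm (ξ i : ℂ) (ξ j : ℂ)]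
  abel

variable (θ : ℝ) (lam : I → ℝ)

theorem mem_circularAlgebra_space_iff {T : FullFock H →L[ℂ] FullFock H} :
    T ∈ (circularAlgebra b θ lam).space ↔
      T ∈ StarSubalgebra.centralizer ℂ (StarSubalgebra.centralizer ℂ
        (Set.range (circularElement b θ lam)) : Set (FullFock H →L[ℂ] FullFock H)) :=
  Iff.rfl

theorem rightCircularCore_mem_centralizer (i : I) :
    rightCircularCore b (circularXi θ lam) i ∈
      StarSubalgebra.centralizer ℂ (Set.range (circularElement b θ lam)) := by
  rw [StarSubalgebra.mem_centralizer_iff]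
  rintro _ ⟨j, rfl⟩
  rw [ContinuousLinearMap.star_eq_adjoint, circularElement,
    map_smulₛₗ ContinuousLinearMap.adjoint, smul_mul_assoc, mul_smul_comm, smul_mul_assoc,
    mul_smul_comm, rightCircularCore_comm, rightCircularCore_comm_adjoint]
  exact ⟨rfl, rfl⟩

/-- If `R_i` is the right circular element, then `R_i TΩ = T R_i Ω = T e'_i`. Pairing with `Ω` gives
`ξ_i ⟨e_i, TΩ⟩ = ⟨T*Ω, e'_i⟩`, the graph relation. Only the inclusion of the algebra in the
commutant of the `R_i` is needed. -/
theorem circularCoefficients_mem_graph [CompleteSpace H] {T : FullFock H →L[ℂ] FullFock H}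
    (hT : T ∈ (circularAlgebra b θ lam).space) :
    circularCoefficients b T ∈ (diagonalOperator (circularXi θ lam)).graph := by
  rw [mem_graph_diagonalOperator]
  intro i
  have h1 := ((StarSubalgebra.mem_centralizer_iff ℂ).1
    ((mem_circularAlgebra_space_iff b θ lam).1 hT) _
    (rightCircularCore_mem_centralizer b θ lam i)).1
  have h2 := DFunLike.congr_fun h1 (vacuum H)
  rw [mul_apply_eq_comp, mul_apply_eq_comp, rightCircularCore_vacuum] at h2
  rw [circularCoefficients_snd, circularCoefficients_fst, lp.star_apply, basisCoefficients_apply,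
    basisCoefficients_apply, ContinuousLinearMap.adjoint_inner_right,
    ContinuousLinearMap.adjoint_inner_right, ContinuousLinearMap.adjoint_inner_right,
    ← inner_vacuum_rightCircularCore, h2]
  exact inner_conj_symm _ _

theorem isClosed_circularAlgebra_space :
    IsClosed ((circularAlgebra b θ lam).space : Set (FullFock H →L[ℂ] FullFock H)) := by
  have : ((circularAlgebra b θ lam).space : Set (FullFock H →L[ℂ] FullFock H)) =
      Set.centralizer (Set.centralizer (Set.range (circularElement b θ lam) ∪
        star (Set.range (circularElement b θ lam)))) :=
    StarSubalgebra.coe_centralizer_centralizer ℂ _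
  rw [this]
  exact Set.isClosed_centralizer _

theorem circularSpan_le : circularSpan b θ lam ≤ (circularAlgebra b θ lam).space := by
  refine Submodule.topologicalClosure_minimal _ (Submodule.span_le.2 ?_)
    (isClosed_circularAlgebra_space b θ lam)
  have : ((circularAlgebra b θ lam).space : Set (FullFock H →L[ℂ] FullFock H)) =
      Set.centralizer (Set.centralizer (Set.range (circularElement b θ lam) ∪
        star (Set.range (circularElement b θ lam)))) :=
    StarSubalgebra.coe_centralizer_centralizer ℂ _
  rw [this]
  exact Set.subset_union_left.trans Set.subset_centralizer_centralizer

theorem isClosed_circularSpan :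
    IsClosed (circularSpan b θ lam : Set (FullFock H →L[ℂ] FullFock H)) :=
  Submodule.isClosed_topologicalClosure _

variable {θ lam}

theorem circularCore_mem_circularSpan (hθ1 : θ < 1) (hlam : ∀ i, 0 < lam i) (i : I) :
    circularCore b (circularXi θ lam) i ∈ circularSpan b θ lam := by
  have h1 : (1 - θ) * lam i ^ (θ / 2) ≠ 0 :=
    mul_ne_zero (sub_pos.2 hθ1).ne' (Real.rpow_pos_of_pos (hlam i) _).ne'
  have h2 : (((1 - θ) * lam i ^ (θ / 2) : ℝ) : ℂ) ≠ 0 := Complex.ofReal_ne_zero.2 h1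
  rw [← Submodule.smul_mem_iff _ h2]
  exact Submodule.le_topologicalClosure _ (Submodule.subset_span ⟨i, rfl⟩)

theorem circularSynthesis_mem_circularSpan [CompleteSpace H] (hθ1 : θ < 1) (hlam : ∀ i, 0 < lam i)
    {p : lp (fun _ : I => ℂ) 2 × lp (fun _ : I => ℂ) 2}
    (hp : p ∈ (diagonalOperator (circularXi θ lam)).graph) :
    circularSynthesis b p ∈ circularSpan b θ lam := by
  classical
  rw [mem_graph_diagonalOperator] at hp
  -- Both coordinates are norm limits of their finite truncations, and truncation preserves the
  -- graph relation.
  have h1 := (lp.hasSum_single (by norm_num) p.1).prodMk (lp.hasSum_single (by norm_num) p.2)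
  have h2 := h1.map (circularSynthesis b).toAddMonoidHom (continuous_circularSynthesis b)
  refine (isClosed_circularSpan b θ lam).mem_of_tendsto h2 (Filter.Eventually.of_forall fun s => ?_)
  refine Submodule.sum_mem _ fun i _ => ?_
  have h3 := circularSynthesis_single b (circularXi θ lam) i (p.1 i)
  rw [← hp i] at h3
  change circularSynthesis b (lp.single 2 i (p.1 i), lp.single 2 i (p.2 i)) ∈ _
  rw [h3]
  exact Submodule.smul_mem _ _ (circularCore_mem_circularSpan b hθ1 hlam i)

theorem circularCoefficients_circularCore [CompleteSpace H] [DecidableEq I] (ξ : I → ℝ) (i : I) :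
    circularCoefficients b (circularCore b ξ i) =
      (lp.single 2 i (1 : ℂ), lp.single 2 i (ξ i : ℂ)) := by
  have h1 := circularSynthesis_single b ξ i 1
  rw [one_smul, mul_one] at h1
  rw [← h1, circularCoefficients_circularSynthesis]

theorem circularSynthesis_circularCoefficients [CompleteSpace H] {T : FullFock H →L[ℂ] FullFock H}
    (hT : T ∈ circularSpan b θ lam) : circularSynthesis b (circularCoefficients b T) = T := by
  classical
  let Φ : (FullFock H →L[ℂ] FullFock H) →ₗ[ℂ] (FullFock H →L[ℂ] FullFock H) :=
    circularSynthesis b ∘ₗ circularCoefficients b - LinearMap.id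
  have hΦ : Continuous Φ :=
    ((continuous_circularSynthesis b).comp (continuous_circularCoefficients b)).sub continuous_id
  have hcl : IsClosed (LinearMap.ker Φ : Set (FullFock H →L[ℂ] FullFock H)) :=
    isClosed_singleton.preimage hΦ
  -- Being fixed by synthesis after analysis is a closed linear condition, so the generators
  -- suffice.
  have hle : circularSpan b θ lam ≤ LinearMap.ker Φ := by
    refine Submodule.topologicalClosure_minimal _ (Submodule.span_le.2 ?_) hcl
    rintro _ ⟨i, rfl⟩
    have h1 := circularSynthesis_single b (circularXi θ lam) i 1
    rw [one_smul, mul_one] at h1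
    change circularSynthesis b (circularCoefficients b (circularElement b θ lam i)) -
      circularElement b θ lam i = 0
    rw [circularElement, map_smul, map_smul, circularCoefficients_circularCore, h1, sub_self]
  exact sub_eq_zero.1 (hle hT)

/-! ### Functionals composed with the projection are normal -/

/-- A bounded functional on the operators on the full Fock space, composed with the projection,
is a sum of two vector functionals. -/
theorem exists_functional_circularSynthesis [CompleteSpace H]
    (g : NormedDual (FullFock H →L[ℂ] FullFock H)) :
    ∃ x y : FullFock H, ∀ T, g (circularSynthesis b (circularCoefficients b T)) =
      ⟪x, T (vacuum H)⟫_ℂ + ⟪vacuum H, T y⟫_ℂ := by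
  let φ : NormedDual H := g ∘L creation
  have hψ : Continuous fun h : H => starRingEnd ℂ (g (ContinuousLinearMap.adjoint (creation h))) :=
    Complex.continuous_conj.comp (g.continuous.comp (ContinuousLinearMap.adjoint.continuous.comp
      creation.continuous))
  -- `h ↦ ℓ(h)*` is antilinear; conjugation makes the Riesz representation applicable.
  let ψ : NormedDual H :=
    { toFun := fun h => starRingEnd ℂ (g (ContinuousLinearMap.adjoint (creation h)))
      map_add' := fun h k => by simp only [map_add]
      map_smul' := fun c h => by
        rw [map_smul, map_smulₛₗ ContinuousLinearMap.adjoint, map_smul]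
        simp
      cont := hψ }
  let u := (InnerProductSpace.toDual ℂ H).symm φ
  let w := (InnerProductSpace.toDual ℂ H).symm ψ
  have hu : ∀ h, g (creation h) = ⟪u, h⟫_ℂ := fun h =>
    (InnerProductSpace.toDual_symm_apply (y := φ)).symm
  have hw : ∀ h, g (ContinuousLinearMap.adjoint (creation h)) = ⟪h, w⟫_ℂ := fun h => by
    rw [← inner_conj_symm, InnerProductSpace.toDual_symm_apply (y := ψ)]
    exact (Complex.conj_conj _).symm
  refine ⟨degreeOne (basisIsometry b Sum.inl_injective (basisCoefficients b Sum.inl_injective u)),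
    degreeOne (basisIsometry b Sum.inr_injective (basisCoefficients b Sum.inr_injective w)),
    fun T => ?_⟩
  have h1 : ∀ z : FullFock H,
      ⟪u, basisIsometry b Sum.inl_injective (basisCoefficients b Sum.inl_injective
        (ContinuousLinearMap.adjoint degreeOne z))⟫_ℂ =
      ⟪degreeOne (basisIsometry b Sum.inl_injective
        (basisCoefficients b Sum.inl_injective u)), z⟫_ℂ := fun z => by
    rw [← inner_basisCoefficients_left, inner_basisCoefficients_right,
      ContinuousLinearMap.adjoint_inner_right]
  have h2 : ∀ z : FullFock H,
      ⟪basisIsometry b Sum.inr_injective (basisCoefficients b Sum.inr_injective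
        (ContinuousLinearMap.adjoint degreeOne z)), w⟫_ℂ =
      ⟪z, degreeOne (basisIsometry b Sum.inr_injective
        (basisCoefficients b Sum.inr_injective w))⟫_ℂ := fun z => by
    rw [← inner_basisCoefficients_right, inner_basisCoefficients_left,
      ContinuousLinearMap.adjoint_inner_left]
  rw [circularSynthesis_apply, map_add, hu, hw, circularCoefficients_fst, circularCoefficients_snd,
    star_star, h1, h2, ContinuousLinearMap.adjoint_inner_left]

end CircularAlgebra

/-! ## Complete boundedness of restrictions, compositions and adjoints -/

section CompletelyBounded

theorem CBNormLE.restrict {E F : Type*} [AddCommGroup E] [Module ℂ E] [AddCommGroup F] [Module ℂ F]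
    {ν : MatrixNorms E} {μ : MatrixNorms F} {u : E →ₗ[ℂ] F} {C : ℝ} (h : CBNormLE ν μ u C)
    {V : Submodule ℂ E} {W : Submodule ℂ F} (w : V →ₗ[ℂ] W) (hw : ∀ x, (w x : F) = u x) :
    CBNormLE (ν.sub V) (μ.sub W) w C := by
  refine ⟨h.1, fun n a => ?_⟩
  have h1 : (a.map w).map W.subtype = (a.map V.subtype).map u := by
    ext1 i j
    exact hw (a i j)
  change μ n ((a.map w).map W.subtype) ≤ _
  rw [h1]
  exact h.2 n _

theorem CBNormLE.comp {E F G : Type*} [AddCommGroup E] [Module ℂ E] [AddCommGroup F] [Module ℂ F]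
    [AddCommGroup G] [Module ℂ G] {ν : MatrixNorms E} {μ : MatrixNorms F} {κ : MatrixNorms G}
    {w : F →ₗ[ℂ] G} {u : E →ₗ[ℂ] F} {C D : ℝ} (hw : CBNormLE μ κ w D) (hu : CBNormLE ν μ u C) :
    CBNormLE ν κ (w ∘ₗ u) (D * C) := by
  refine ⟨mul_nonneg hw.1 hu.1, fun n a => (hw.2 n (a.map u)).trans ?_⟩
  rw [mul_assoc]
  exact mul_le_mul_of_nonneg_left (hu.2 n a) hw.1

theorem CBNormLE.id {E : Type*} [AddCommGroup E] [Module ℂ E] (ν : MatrixNorms E) :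
    CBNormLE ν ν LinearMap.id 1 :=
  ⟨zero_le_one, fun n a => (one_mul (ν n a)).ge⟩

/-- The adjoint of a completely bounded map is completely bounded. -/
theorem dual_comp_le {E F : Type*} [NormedAddCommGroup E] [NormedSpace ℂ E] [NormedAddCommGroup F]
    [NormedSpace ℂ F] {ν : MatrixNorms E} {μ : MatrixNorms F} (u : E →L[ℂ] F) {C : ℝ} (hC : 0 < C)
    (hu : CBNormLE ν μ u.toLinearMap C) {n : ℕ} (f : Matrix (Fin n) (Fin n) (NormedDual F))
    (hf : ∃ D : ℝ, 0 ≤ D ∧ ∀ (m : ℕ) (x : Matrix (Fin m) (Fin m) F),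
      ‖Matrix.toEuclideanCLM (𝕜 := ℂ) (n := Fin n × Fin m)
        (Matrix.of fun p q => f p.1 q.1 (x p.2 q.2))‖ ≤ D * μ m x) :
    ν.dual n (Matrix.of fun i j => f i j ∘L u) ≤ C * μ.dual n f := by
  rw [← div_le_iff₀' hC]
  refine le_csInf hf fun D hD => ?_
  rw [div_le_iff₀' hC]
  refine csInf_le ⟨0, fun D hD => hD.1⟩ ⟨mul_nonneg hC.le hD.1, fun m x => ?_⟩
  refine (hD.2 m (x.map u)).trans ?_
  rw [mul_comm C D, mul_assoc]
  exact mul_le_mul_of_nonneg_left (hu.2 m x) hD.1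

/-- Ensures that the set whose infimum defines the dual matrix norm is nonempty; otherwise that
infimum would take the default value 0. The size of the bound is immaterial. -/
theorem exists_norm_matrix_functional_le {K : Type*} [NormedAddCommGroup K] [InnerProductSpace ℂ K]
    (V : Submodule ℂ (K →L[ℂ] K)) {n : ℕ} (f : Matrix (Fin n) (Fin n) (NormedDual V)) :
    ∃ D : ℝ, 0 ≤ D ∧ ∀ (m : ℕ) (x : Matrix (Fin m) (Fin m) V),
      ‖Matrix.toEuclideanCLM (𝕜 := ℂ) (n := Fin n × Fin m)
        (Matrix.of fun p q => f p.1 q.1 (x p.2 q.2))‖ ≤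
      D * (MatrixNorms.operators K K).sub V m x := by
  choose M hM hf using fun i j => exists_norm_apply_le (f i j)
  exact ⟨∑ i, ∑ j, M i j, Finset.sum_nonneg fun i _ => Finset.sum_nonneg fun j _ => hM i j,
    fun m x => norm_matrix_functional_le V f M hM hf x⟩

/-- If `X` is completely complemented in a von Neumann algebra, by a projection whose adjoint takes
values in the predual, then the dual of `X` embeds into the predual. -/
theorem isCompletelyIsomorphicEmbedding_of_retraction {K : Type*} [NormedAddCommGroup K]
    [InnerProductSpace ℂ K] [CompleteSpace K] {M : VonNeumannAlgebra K}
    {X : Submodule ℂ (K →L[ℂ] K)} (r : M.space →L[ℂ] X) (s : X →L[ℂ] M.space)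
    (hrs : ∀ x, r (s x) = x) {C D : ℝ} (hC : 0 < C) (hD : 0 < D)
    (hr : CBNormLE M.matrixNorms ((MatrixNorms.operators K K).sub X) r.toLinearMap C)
    (hs : CBNormLE ((MatrixNorms.operators K K).sub X) M.matrixNorms s.toLinearMap D)
    (J : NormedDual X →ₗ[ℂ] M.predual) (hJ : ∀ f, (J f : NormedDual M.space) = f ∘L r) :
    IsCompletelyIsomorphicEmbedding ((MatrixNorms.operators K K).sub X).dual
      M.predualMatrixNorms J := by
  -- Composition with `s` is a left inverse of `J`. It gives injectivity and, being the adjoint of a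
  -- completely bounded map, the lower estimate.
  have hJs : ∀ f, (J f : NormedDual M.space) ∘L s = f := fun f => by
    rw [hJ]
    ext x
    exact congrArg f (hrs x)
  refine ⟨fun f g hfg => ?_, ⟨C, hC.le, fun n f => ?_⟩, D, hD.le, fun n f => ?_⟩
  · rw [← hJs f, hfg, hJs]
  · have h1 : (f.map J).map M.predual.subtype = Matrix.of fun i j => f i j ∘L r := by
      ext1 i j
      exact hJ (f i j)
    change M.matrixNorms.dual n ((f.map J).map M.predual.subtype) ≤ _
    rw [h1]
    exact dual_comp_le r hC hr f (exists_norm_matrix_functional_le X f)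
  · have h1 : f = Matrix.of fun i j => ((f.map J).map M.predual.subtype) i j ∘L s := by
      ext1 i j
      exact (hJs (f i j)).symm
    have h2 := dual_comp_le s hD hs ((f.map J).map M.predual.subtype)
      (exists_norm_matrix_functional_le M.space _)
    rw [← h1] at h2
    exact h2

end CompletelyBounded

/-! ## The projection and the complete isomorphism -/

section CircularMaps

variable {I : Type v} {H : Type u} [NormedAddCommGroup H] [InnerProductSpace ℂ H]
  (b : HilbertBasis (I ⊕ I) ℂ H) {θ : ℝ} {lam : I → ℝ}

/-- The inclusion of the closed span of the circular elements into the von Neumann algebra. -/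
def circularInclusion : circularSpan b θ lam →L[ℂ] (circularAlgebra b θ lam).space where
  toLinearMap := Submodule.inclusion (circularSpan_le b θ lam)
  cont := continuous_subtype_val.subtype_mk _

theorem cbNormLE_circularInclusion :
    CBNormLE ((MatrixNorms.operators (FullFock H) (FullFock H)).sub (circularSpan b θ lam))
      (circularAlgebra b θ lam).matrixNorms (circularInclusion b).toLinearMap 1 :=
  (CBNormLE.id (MatrixNorms.operators (FullFock H) (FullFock H))).restrict _ fun _ => rfl

variable [CompleteSpace H]

/-- The projection of the von Neumann algebra onto the closed span of the circular elements. -/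
def circularRetraction (hθ1 : θ < 1) (hlam : ∀ i, 0 < lam i) :
    (circularAlgebra b θ lam).space →L[ℂ] circularSpan b θ lam where
  toLinearMap := (circularSynthesis b ∘ₗ circularCoefficients b ∘ₗ
    (circularAlgebra b θ lam).space.subtype).codRestrict (circularSpan b θ lam) fun T =>
      circularSynthesis_mem_circularSpan b hθ1 hlam (circularCoefficients_mem_graph b θ lam T.2)
  cont := ((continuous_circularSynthesis b).comp
    ((continuous_circularCoefficients b).comp continuous_subtype_val)).subtype_mk _

variable (hθ1 : θ < 1) (hlam : ∀ i, 0 < lam i)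

theorem circularRetraction_circularInclusion (T : circularSpan b θ lam) :
    circularRetraction b hθ1 hlam (circularInclusion b T) = T :=
  Subtype.ext (circularSynthesis_circularCoefficients b T.2)

theorem cbNormLE_circularRetraction :
    CBNormLE (circularAlgebra b θ lam).matrixNorms
      ((MatrixNorms.operators (FullFock H) (FullFock H)).sub (circularSpan b θ lam))
      (circularRetraction b hθ1 hlam).toLinearMap 2 := by
  have h1 := (cbNormLE_circularSynthesis b).comp (cbNormLE_circularCoefficients b)
  rw [mul_one] at h1
  exact h1.restrict _ fun _ => rfl

/-- The isomorphism of the closed span of the circular elements onto the graph of the diagonal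
operator. -/
def circularSpanEquivGraph :
    circularSpan b θ lam ≃ₗ[ℂ] (diagonalOperator (circularXi θ lam)).graph :=
  LinearEquiv.ofLinearMap
    ((circularCoefficients b ∘ₗ (circularSpan b θ lam).subtype).codRestrict _ fun T =>
      circularCoefficients_mem_graph b θ lam (circularSpan_le b θ lam T.2))
    ((circularSynthesis b ∘ₗ (diagonalOperator (circularXi θ lam)).graph.subtype).codRestrict _
      fun p => circularSynthesis_mem_circularSpan b hθ1 hlam p.2)
    (LinearMap.ext fun _ => Subtype.ext (circularCoefficients_circularSynthesis b _))
    (LinearMap.ext fun T => Subtype.ext (circularSynthesis_circularCoefficients b T.2))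

theorem coe_circularSpanEquivGraph (T : circularSpan b θ lam) :
    (circularSpanEquivGraph b hθ1 hlam T : lp (fun _ : I => ℂ) 2 × lp (fun _ : I => ℂ) 2) =
      circularCoefficients b T := rfl

theorem isCompleteIsomorphism_circularSpanEquivGraph :
    IsCompleteIsomorphism
      ((MatrixNorms.operators (FullFock H) (FullFock H)).sub (circularSpan b θ lam))
      (graphMatrixNorms (circularXi θ lam)) (circularSpanEquivGraph b hθ1 hlam) :=
  ⟨⟨1, (cbNormLE_circularCoefficients b).restrict _ fun _ => rfl⟩,
    ⟨2, (cbNormLE_circularSynthesis b).restrict _ fun _ => rfl⟩⟩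

/-! ### The embedding of the dual into the predual -/

theorem comp_circularRetraction_mem_predual (f : NormedDual (circularSpan b θ lam)) :
    f ∘L circularRetraction b hθ1 hlam ∈ (circularAlgebra b θ lam).predual := by
  -- A Hahn–Banach extension makes `f` act on all creation and annihilation operators, as the Riesz
  -- argument requires. The choice is harmless because the projection takes values in `X`.
  obtain ⟨g, hg, -⟩ := exists_extension_norm_eq (circularSpan b θ lam) f
  obtain ⟨x, y, hxy⟩ := exists_functional_circularSynthesis b g
  have h1 : f ∘L circularRetraction b hθ1 hlam =
      (circularAlgebra b θ lam).vectorFunctional (vacuum H) x +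
        (circularAlgebra b θ lam).vectorFunctional y (vacuum H) := by
    ext T
    exact (hg _).symm.trans (hxy T)
  rw [h1]
  exact Submodule.le_topologicalClosure _ (Submodule.add_mem _
    (Submodule.subset_span ⟨(vacuum H, x), rfl⟩) (Submodule.subset_span ⟨(y, vacuum H), rfl⟩))

/-- The map `f ↦ f ∘ P` from the dual of the closed span of the circular elements to the predual
of the von Neumann algebra. -/
def circularDualEmbedding :
    NormedDual (circularSpan b θ lam) →ₗ[ℂ] (circularAlgebra b θ lam).predual where
  toFun f := ⟨f ∘L circularRetraction b hθ1 hlam, comp_circularRetraction_mem_predual b hθ1 hlam f⟩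
  map_add' _ _ := rfl
  map_smul' _ _ := rfl

theorem isCompletelyIsomorphicEmbedding_circularDualEmbedding :
    IsCompletelyIsomorphicEmbedding
      ((MatrixNorms.operators (FullFock H) (FullFock H)).sub (circularSpan b θ lam)).dual
      (circularAlgebra b θ lam).predualMatrixNorms (circularDualEmbedding b hθ1 hlam) :=
  isCompletelyIsomorphicEmbedding_of_retraction (circularRetraction b hθ1 hlam)
    (circularInclusion b) (circularRetraction_circularInclusion b hθ1 hlam) zero_lt_two
    zero_lt_one (cbNormLE_circularRetraction b hθ1 hlam) (cbNormLE_circularInclusion b) _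
    fun _ => rfl

/-- For `f` in the predual, `f ∘ P` is the image of `f` restricted to `X` under the dual embedding.
It is therefore again in the predual, and evaluation at it is weak*-continuous. -/
theorem isNormalMap_circularInclusion_comp_circularRetraction :
    (circularAlgebra b θ lam).IsNormalMap
      ((circularInclusion b).toLinearMap ∘ₗ (circularRetraction b hθ1 hlam).toLinearMap) := by
  refine continuous_induced_rng.2 (@continuous_pi _ _ _ (circularAlgebra b θ lam).weakStarTopology
    _ _ fun f => ?_)
  let φ : (circularAlgebra b θ lam).predual := circularDualEmbedding b hθ1 hlam
    ((f : NormedDual (circularAlgebra b θ lam).space) ∘L circularInclusion b)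
  have hφ : @Continuous _ _ (circularAlgebra b θ lam).weakStarTopology _
      fun T => (φ : NormedDual (circularAlgebra b θ lam).space) T :=
    @Continuous.comp _ _ _ (circularAlgebra b θ lam).weakStarTopology _ _
      (fun T (g : (circularAlgebra b θ lam).predual) =>
        (g : NormedDual (circularAlgebra b θ lam).space) T) (fun p => p φ)
      (continuous_apply φ) continuous_induced_dom
  exact hφ

theorem range_circularInclusion_comp_circularRetraction :
    (LinearMap.range ((circularInclusion b).toLinearMap ∘ₗ
      (circularRetraction b hθ1 hlam).toLinearMap)).map (circularAlgebra b θ lam).space.subtype =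
      circularSpan b θ lam := by
  ext T
  constructor
  · rintro ⟨_, ⟨S, rfl⟩, rfl⟩
    exact (circularRetraction b hθ1 hlam S).2
  · intro hT
    refine ⟨circularInclusion b ⟨T, hT⟩, ⟨circularInclusion b ⟨T, hT⟩, ?_⟩, rfl⟩
    exact congrArg (circularInclusion b) (circularRetraction_circularInclusion b hθ1 hlam ⟨T, hT⟩)

end CircularMaps

end

theorem lemma22 {I : Type*} [DecidableEq I] {H : Type*} [NormedAddCommGroup H]
    [InnerProductSpace ℂ H] [CompleteSpace H] (b : HilbertBasis (I ⊕ I) ℂ H)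
    (θ : ℝ) (hθ0 : 0 < θ) (hθ1 : θ < 1) (lam : I → ℝ) (hlam : ∀ i, 0 < lam i) :
    -- the projection
    (∃ P : (circularAlgebra b θ lam).space →ₗ[ℂ] (circularAlgebra b θ lam).space,
      (∀ T, (P T : FullFock H →L[ℂ] FullFock H) = circularProjection b T) ∧
      (circularAlgebra b θ lam).IsNormalMap P ∧
      (∀ T, P (P T) = P T) ∧
      (LinearMap.range P).map (circularAlgebra b θ lam).space.subtype = circularSpan b θ lam ∧
      CBNormLE (circularAlgebra b θ lam).matrixNorms (circularAlgebra b θ lam).matrixNorms P 2) ∧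
    -- the range is completely isomorphic to the graph space
    (∃ V : circularSpan b θ lam ≃ₗ[ℂ] (diagonalOperator (circularXi θ lam)).graph,
      (∀ (i : I) (z : circularSpan b θ lam),
        (z : FullFock H →L[ℂ] FullFock H) = circularCore b (circularXi θ lam) i →
        (V z : lp (fun _ : I => ℂ) 2 × lp (fun _ : I => ℂ) 2) =
          (lp.single 2 i (1 : ℂ), lp.single 2 i (circularXi θ lam i : ℂ))) ∧
      IsCompleteIsomorphism
        ((MatrixNorms.operators (FullFock H) (FullFock H)).sub (circularSpan b θ lam))
        (graphMatrixNorms (circularXi θ lam)) V) ∧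
    -- the dual of the range embeds in the predual
    (∃ J : NormedDual (circularSpan b θ lam) →ₗ[ℂ] (circularAlgebra b θ lam).predual,
      IsCompletelyIsomorphicEmbedding
        ((MatrixNorms.operators (FullFock H) (FullFock H)).sub (circularSpan b θ lam)).dual
        (circularAlgebra b θ lam).predualMatrixNorms J) := by
  refine ⟨⟨(circularInclusion b).toLinearMap ∘ₗ (circularRetraction b hθ1 hlam).toLinearMap,
    fun T => (circularProjection_eq b T).symm,
    isNormalMap_circularInclusion_comp_circularRetraction b hθ1 hlam, fun T => ?_,
    range_circularInclusion_comp_circularRetraction b hθ1 hlam, ?_⟩,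
    ⟨circularSpanEquivGraph b hθ1 hlam, fun i z hz => ?_,
      isCompleteIsomorphism_circularSpanEquivGraph b hθ1 hlam⟩,
    ⟨circularDualEmbedding b hθ1 hlam,
      isCompletelyIsomorphicEmbedding_circularDualEmbedding b hθ1 hlam⟩⟩
  · exact congrArg (circularInclusion b) (circularRetraction_circularInclusion b hθ1 hlam _)
  · have h1 := (cbNormLE_circularInclusion b (θ := θ) (lam := lam)).comp
      (cbNormLE_circularRetraction b hθ1 hlam)
    rwa [one_mul] at h1
  · rw [coe_circularSpanEquivGraph, hz, circularCoefficients_circularCore]
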